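/- **Theorem (strong law of large numbers).** Let $(E,\mathcal A,\mu)$ be a probability space, let $T:E\to E$ be an invertible bi-measurable map that preserves $\mu$, and let $f:E\to[0,1]$ be measurable with $\int_E f\,d\mu=\frac12$. For $x\in E$ let $\mathbb P_T^{(x)}$ be the product probability measure on $\{-1,+1\}^{\mathbb Z}$ with marginals $\mathbb P_T^{(x)}(\epsilon_y=+1)=f(T^yx)$, $y\in\mathbb Z$, and let $\mathbb P_\mu[A]=\int_E\mathbb P_T^{(x)}[A]\,d\mu(x)$ for measurable $A\subseteq\{-1,+1\}^{\mathbb Z}$. For $\epsilon\in\{-1,+1\}^{\mathbb Z}$ let $\mathbb L^\epsilon$ be the directed graph with vertex set $\mathbb Z^2$ that has an edge from $u=(u_1,u_2)$ to $v=(v_1,v_2)$ if and only if either $v_1=u_1$ and $v_2=u_2\pm1$, or $v_2=u_2$ and $v_1=u_1+\epsilon_{u_2}$. Let $(\Omega,\mathcal B,\mathbb P)$ be a probability space and let $M=(M_n)_{n\ge0}$ be the simple random walk on $\mathbb L^\epsilon$: each $M_n:\Omega\times\{-1,+1\}^{\mathbb Z}\to\mathbb Z^2$ is measurable and, for every fixed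 $\epsilon$, $(M_n(\cdot,\epsilon))_{n\ge0}$ is under $\mathbb P$ a Markov chain with transition probabilities $\frac13$ from $u$ to $v$ if $(u,v)$ is an edge of $\mathbb L^\epsilon$, and $0$ otherwise (with an arbitrary initial position, for instance the origin). If the dynamical system $(E,\mathcal A,\mu,T)$ is ergodic, then the walk has zero speed: $$\lim_{n\to\infty}\frac{M_n}{n}=(0,0)\qquad \mathbb P\otimes\mathbb P_\mu\text{-almost surely.}$$ -/

import Mathlib

open MeasureTheory Filter Topology
open scoped ENNReal unitInterval

/-- The law on `{-1, +1}` (the units of `ℤ`) giving mass `p` to `+1` and `1 - p` to `-1`. -/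
noncomputable def signLaw (p : I) : Measure ℤˣ :=
  ENNReal.ofReal (p : ℝ) • Measure.dirac 1 + ENNReal.ofReal (1 - (p : ℝ)) • Measure.dirac (-1)

instance signLaw.instIsProbabilityMeasure (p : I) : IsProbabilityMeasure (signLaw p) := by
  refine ⟨?_⟩
  have h0 : (0 : ℝ) ≤ p := p.2.1
  have h1 : (0 : ℝ) ≤ 1 - p := sub_nonneg.2 p.2.2
  simp [signLaw, ← ENNReal.ofReal_add h0 h1]

/-- The quenched law of the orientations for `x : E`: the product probability measure on
`{-1, +1}^ℤ` under which `ε y = +1` has probability `f (T ^ y x)`. -/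
noncomputable def quenchedLaw {E : Type*} [MeasurableSpace E] (T : E ≃ᵐ E) (f : E → I) (x : E) :
    Measure (ℤ → ℤˣ) :=
  Measure.infinitePi fun y : ℤ => signLaw (f ((T.toEquiv ^ y : Equiv.Perm E) x))

instance quenchedLaw.instIsProbabilityMeasure {E : Type*} [MeasurableSpace E] (T : E ≃ᵐ E)
    (f : E → I) (x : E) : IsProbabilityMeasure (quenchedLaw T f x) := by
  unfold quenchedLaw; infer_instance

/-- The annealed law of the orientations, `A ↦ ∫ quenchedLaw T f x A dμ(x)`. -/
noncomputable def annealedLaw {E : Type*} [MeasurableSpace E] (μ : Measure E) (T : E ≃ᵐ E)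
    (f : E → I) : Measure (ℤ → ℤˣ) :=
  μ.bind (quenchedLaw T f)

lemma measurable_zpow_perm {E : Type*} [MeasurableSpace E] (T : E ≃ᵐ E) (y : ℤ) :
    Measurable fun x => (T.toEquiv ^ y : Equiv.Perm E) x := by
  have key : ∀ (S : E ≃ᵐ E) (n : ℕ), Measurable fun x => (S.toEquiv ^ n : Equiv.Perm E) x := by
    intro S n
    induction n with
    | zero => exact measurable_id
    | succ n ih => simpa [pow_succ, Function.comp_def] using ih.comp S.measurable
  cases y with
  | ofNat n => simpa using key T n
  | negSucc n =>
    have h := key T.symm (n + 1)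
    have e : (T.symm.toEquiv : Equiv.Perm E) = (T.toEquiv : Equiv.Perm E)⁻¹ := rfl
    rw [e] at h
    simpa [zpow_negSucc] using h

lemma measurable_signLaw_apply (s : Set ℤˣ) : Measurable fun p : I => signLaw p s := by
  simp only [signLaw, Measure.add_apply, Measure.smul_apply, smul_eq_mul]
  exact ((ENNReal.measurable_ofReal.comp measurable_subtype_coe).mul_const _).add
    ((ENNReal.measurable_ofReal.comp (measurable_const.sub measurable_subtype_coe)).mul_const _)

lemma measurable_quenchedLaw {E : Type*} [MeasurableSpace E] (T : E ≃ᵐ E) {f : E → I}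
    (hf : Measurable f) : Measurable (quenchedLaw T f) := by
  refine Measurable.measure_of_isPiSystem_of_isProbabilityMeasure
    (generateFrom_squareCylinders (α := fun _ : ℤ => ℤˣ)).symm
    (isPiSystem_squareCylinders (fun _ => MeasurableSpace.isPiSystem_measurableSet) (by simp)) ?_
  rintro _ ⟨s, t, ht, rfl⟩
  have ht' : ∀ i, MeasurableSet (t i) := fun i => ht i (Set.mem_univ i)
  have h : ∀ x, quenchedLaw T f x ((s : Set ℤ).pi t) =
      ∏ y ∈ s, signLaw (f ((T.toEquiv ^ y : Equiv.Perm E) x)) (t y) := fun x =>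
    Measure.infinitePi_pi _ (fun i _ => ht' i)
  simp only [h]
  exact Finset.measurable_prod _ fun y _ =>
    (measurable_signLaw_apply (t y)).comp (hf.comp (measurable_zpow_perm T y))

lemma annealedLaw_apply {E : Type*} [MeasurableSpace E] (μ : Measure E) (T : E ≃ᵐ E) {f : E → I}
    (hf : Measurable f) {A : Set (ℤ → ℤˣ)} (hA : MeasurableSet A) :
    annealedLaw μ T f A = ∫⁻ x, quenchedLaw T f x A ∂μ :=
  Measure.bind_apply hA (measurable_quenchedLaw T hf).aemeasurable

/-- The oriented lattice attached to the orientations `ε`: vertical lines are not oriented, the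
horizontal line at level `y` is oriented in the direction `ε y`. -/
def orientedLattice (ε : ℤ → ℤˣ) : Digraph (ℤ × ℤ) where
  Adj u v := (v.1 = u.1 ∧ (v.2 = u.2 + 1 ∨ v.2 = u.2 - 1)) ∨
    (v.2 = u.2 ∧ v.1 = u.1 + (ε u.2 : ℤ))

open Classical in
/-- The transition probabilities of the simple random walk on the oriented lattice. -/
noncomputable def transitionProb (ε : ℤ → ℤˣ) (u v : ℤ × ℤ) : ℝ≥0∞ :=
  if (orientedLattice ε).Adj u v then 1 / 3 else 0

/-- `M` is a Markov chain under `P` with the transition probabilities of the simple random walk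
on the oriented lattice attached to `ε`. -/
structure IsSimpleRandomWalk {Ω : Type*} [MeasurableSpace Ω] (P : Measure Ω) (ε : ℤ → ℤˣ)
    (M : ℕ → Ω → ℤ × ℤ) : Prop where
  measurable : ∀ n, Measurable (M n)
  markov : ∀ (n : ℕ) (u : ℕ → ℤ × ℤ),
    P {ω | ∀ k ≤ n + 1, M k ω = u k} =
      P {ω | ∀ k ≤ n, M k ω = u k} * transitionProb ε (u n) (u (n + 1))

/-! Up to its starting point, the walk is a pair of Birkhoff sums over the environment seen from the
walker. The state is a sequence of i.i.d. uniform steps (down, horizontal, up) with the orientations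
recentred at the current height; `envStep` consumes a step and translates the orientations. This map
preserves `stepsLaw.prod ν` for the annealed law `ν`, because `ν` is shift invariant. It remains to
show that the ergodic averages of two bounded observables tend to zero almost everywhere.

Ergodicity of `envStep` is not needed. For a bounded observable, Cesàro decay of correlations gives
mean-square convergence (`tendsto_integral_birkhoffSum_sq_div`), and the maximal inequality upgrades
it to almost everywhere convergence (`ae_tendsto_birkhoffSum_div_of_mean_square`).

Vertical steps are centred and independent, so their correlations vanish. Horizontal correlations
are `⟪e, P ^ k e⟫ / 9`, where `e` is the sign at level `0` and `P = (U⁻¹ + 1 + U) / 3` with `U` the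
Koopman operator of the shift. By von Neumann's theorem their averages vanish if `e` is orthogonal
to the vectors fixed by `P`; strict convexity shows that these are fixed by `U`, so decay along the
shift suffices. By conditional independence of the signs given `x`, that reduces to the correlations
of `2f - 1` along `T`; this function is centred, and ergodicity of `T` applies.

Finally `IsSimpleRandomWalk.map_eq` identifies the law of the given chain with that of the walk
built from i.i.d. steps. -/

section MaximalErgodic

/-! ### Maximal ergodic inequality -/

variable {X : Type*}

/-- The maximal function `x ↦ max_{0 ≤ k ≤ n} ∑_{j < k} g (S^j x)`, defined recursively. -/
def birkhoffMax (S : X → X) (g : X → ℝ) : ℕ → X → ℝ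
  | 0, _ => 0
  | n + 1, x => max 0 (g x + birkhoffMax S g n (S x))

lemma birkhoffMax_nonneg (S : X → X) (g : X → ℝ) (n : ℕ) (x : X) : 0 ≤ birkhoffMax S g n x := by
  cases n with
  | zero => exact le_rfl
  | succ n => exact le_max_left _ _

lemma birkhoffMax_le_succ (S : X → X) (g : X → ℝ) (n : ℕ) (x : X) :
    birkhoffMax S g n x ≤ birkhoffMax S g (n + 1) x := by
  induction n generalizing x with
  | zero => exact birkhoffMax_nonneg S g 1 x
  | succ n ih =>
    rw [birkhoffMax, birkhoffMax]
    exact max_le_max le_rfl (add_le_add le_rfl (ih (S x)))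

lemma birkhoffSum_le_birkhoffMax (S : X → X) (g : X → ℝ) (n : ℕ) (x : X) :
    birkhoffSum S g n x ≤ birkhoffMax S g n x := by
  induction n generalizing x with
  | zero => simp [birkhoffMax]
  | succ n ih =>
    rw [birkhoffSum_succ', birkhoffMax]
    exact (add_le_add le_rfl (ih (S x))).trans (le_max_right _ _)

variable [MeasurableSpace X]

lemma measurable_birkhoffSum {S : X → X} (hS : Measurable S) {g : X → ℝ} (hg : Measurable g)
    (n : ℕ) : Measurable (birkhoffSum S g n) :=
  Finset.measurable_fun_sum _ fun k _ => hg.comp (hS.iterate k)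

lemma integrable_birkhoffMax {m : Measure X} {S : X → X} (hS : MeasurePreserving S m m)
    {g : X → ℝ} (hg : Integrable g m) (n : ℕ) :
    Integrable (birkhoffMax S g n) m := by
  induction n with
  | zero => exact integrable_zero _ _ _
  | succ n ih => exact (integrable_zero _ _ _).sup (hg.add (hS.integrable_comp_of_integrable ih))

lemma measurable_birkhoffMax {S : X → X} (hS : Measurable S) {g : X → ℝ} (hg : Measurable g)
    (n : ℕ) : Measurable (birkhoffMax S g n) := by
  induction n with
  | zero => exact measurable_const
  | succ n ih => exact measurable_const.max (hg.add (ih.comp hS))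

/-- The maximal ergodic theorem. -/
theorem setIntegral_birkhoffMax_pos_nonneg {m : Measure X} {S : X → X}
    (hS : MeasurePreserving S m m) {g : X → ℝ} (hgm : Measurable g) (hg : Integrable g m) (n : ℕ) :
    0 ≤ ∫ x in {x | 0 < birkhoffMax S g n x}, g x ∂m := by
  cases n with
  | zero => simp [birkhoffMax]
  | succ n =>
    have hI := integrable_birkhoffMax hS hg
    have hIS : Integrable (fun x => birkhoffMax S g n (S x)) m :=
      hS.integrable_comp_of_integrable (hI n)
    set D := {x | 0 < birkhoffMax S g (n + 1) x} with hD
    have hDm : MeasurableSet D :=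
      measurableSet_lt measurable_const (measurable_birkhoffMax hS.measurable hgm _)
    -- On `D` the maximum in the recursion is its second entry, so the integrand equals `g`; off `D`
    -- it is at most `0`.
    have h1 : ∫ x, birkhoffMax S g (n + 1) x - birkhoffMax S g n (S x) ∂m ≤
        ∫ x in D, g x ∂m := by
      rw [← integral_indicator hDm]
      refine integral_mono ((hI (n + 1)).sub hIS) (hg.indicator hDm) fun x => ?_
      by_cases hx : x ∈ D
      · simp only [Set.indicator_of_mem hx]
        have h2 : 0 < birkhoffMax S g (n + 1) x := hx
        rw [birkhoffMax] at h2 ⊢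
        rcases lt_max_iff.1 h2 with h | h
        · exact absurd h (lt_irrefl _)
        · rw [max_eq_right h.le]; linarith
      · simp only [Set.indicator_of_notMem hx]
        have h2 : birkhoffMax S g (n + 1) x ≤ 0 := not_lt.1 hx
        have h3 := birkhoffMax_nonneg S g n (S x)
        linarith
    refine le_trans ?_ h1
    have h4 : ∫ x, birkhoffMax S g n (S x) ∂m = ∫ x, birkhoffMax S g n x ∂m := by
      have := integral_map (μ := m) hS.measurable.aemeasurable
        (f := birkhoffMax S g n) (measurable_birkhoffMax hS.measurable hgm n).aestronglyMeasurable
      rw [← this, hS.map_eq]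
    rw [integral_sub (hI (n + 1)) hIS, h4, sub_nonneg]
    exact integral_mono (hI n) (hI (n + 1)) fun x => birkhoffMax_le_succ S g n x

/-- The weak type maximal inequality for ergodic averages. -/
theorem measure_exists_birkhoffSum_gt_le {m : Measure X} [IsProbabilityMeasure m] {S : X → X}
    (hS : MeasurePreserving S m m) {h : X → ℝ} (hhm : Measurable h) (hh : Integrable h m)
    (h0 : ∀ x, 0 ≤ h x) {δ : ℝ} (hδ : 0 < δ) :
    m {x | ∃ n : ℕ, n * δ < birkhoffSum S h n x} ≤ ENNReal.ofReal ((∫ x, h x ∂m) / δ) := by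
  set g : X → ℝ := fun x => h x - δ with hg
  have hgm : Measurable g := hhm.sub_const δ
  have hgi : Integrable g m := hh.sub (integrable_const δ)
  set D : ℕ → Set X := fun n => {x | 0 < birkhoffMax S g n x}
  have hDm n : MeasurableSet (D n) :=
    measurableSet_lt measurable_const (measurable_birkhoffMax hS.measurable hgm _)
  have hmono : Monotone D := monotone_nat_of_le_succ fun n x (hx : 0 < _) =>
    hx.trans_le (birkhoffMax_le_succ S g n x)
  have hbound n : m (D n) ≤ ENNReal.ofReal ((∫ x, h x ∂m) / δ) := by
    have h1 := setIntegral_birkhoffMax_pos_nonneg hS hgm hgi n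
    rw [hg, integral_sub hh.integrableOn (integrable_const δ).integrableOn, setIntegral_const,
      smul_eq_mul] at h1
    have h2 : ∫ x in D n, h x ∂m ≤ ∫ x, h x ∂m :=
      setIntegral_le_integral hh (Eventually.of_forall h0)
    have h3 : m.real (D n) ≤ (∫ x, h x ∂m) / δ := by
      rw [le_div_iff₀ hδ]; linarith
    rw [← ofReal_measureReal]
    exact ENNReal.ofReal_le_ofReal h3
  have hsub : {x | ∃ n : ℕ, n * δ < birkhoffSum S h n x} ⊆ ⋃ n, D n := by
    rintro x ⟨n, hn⟩
    refine Set.mem_iUnion.2 ⟨n, lt_of_lt_of_le ?_ (birkhoffSum_le_birkhoffMax S g n x)⟩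
    have : birkhoffSum S g n x = birkhoffSum S h n x - n * δ := by
      simp [birkhoffSum, hg, Finset.sum_sub_distrib]
    linarith
  calc m _ ≤ m (⋃ n, D n) := measure_mono hsub
    _ = ⨆ n, m (D n) := hmono.measure_iUnion
    _ ≤ _ := iSup_le hbound

end MaximalErgodic

/-! ### From Cesàro decay of correlations to almost everywhere convergence -/

section Correlations

variable {X : Type*}

lemma abs_birkhoffSum_le {S : X → X} {F : X → ℝ} (hF : ∀ x, |F x| ≤ 1) (n : ℕ) (x : X) :
    |birkhoffSum S F n x| ≤ n := by
  refine (Finset.abs_sum_le_sum_abs _ _).trans ?_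
  simpa using Finset.sum_le_card_nsmul (Finset.range n) _ 1 fun k _ => hF (S^[k] x)

/-- The time windows `[0, n)` and `[k, n + k)` differ by at most `k` terms at each end. -/
lemma abs_birkhoffSum_sub_le {S : X → X} {F : X → ℝ} (hF : ∀ x, |F x| ≤ 1) (n k : ℕ) (x : X) :
    |birkhoffSum S F n x - birkhoffSum S F n (S^[k] x)| ≤ 2 * k := by
  have h1 := birkhoffSum_add S F n k x
  have h2 := birkhoffSum_add S F k n x
  rw [add_comm k n] at h2
  have h3 := abs_le.1 (abs_birkhoffSum_le (S := S) hF k x)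
  have h4 := abs_le.1 (abs_birkhoffSum_le (S := S) hF k (S^[n] x))
  rw [abs_le]
  constructor <;> linarith

lemma sum_birkhoffSum_iterate (S : X → X) (F : X → ℝ) (n N : ℕ) (x : X) :
    ∑ k ∈ Finset.range N, birkhoffSum S F n (S^[k] x) = birkhoffSum S (birkhoffSum S F N) n x := by
  simp only [birkhoffSum]
  rw [Finset.sum_comm]
  refine Finset.sum_congr rfl fun i _ => Finset.sum_congr rfl fun j _ => ?_
  rw [← Function.iterate_add_apply, ← Function.iterate_add_apply, add_comm]

/-- Averaging a bounded observable along the orbit changes its Birkhoff sums by a bounded amount. -/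
lemma mul_abs_birkhoffSum_le {S : X → X} {F : X → ℝ} (hF : ∀ x, |F x| ≤ 1) (n N : ℕ) (x : X) :
    N * |birkhoffSum S F n x| ≤
      birkhoffSum S (fun y => |birkhoffSum S F N y|) n x + 2 * N * N := by
  have h1 : N * birkhoffSum S F n x = birkhoffSum S (birkhoffSum S F N) n x +
      ∑ k ∈ Finset.range N, (birkhoffSum S F n x - birkhoffSum S F n (S^[k] x)) := by
    rw [← sum_birkhoffSum_iterate, Finset.sum_sub_distrib]; simp
  have h2 : |∑ k ∈ Finset.range N, (birkhoffSum S F n x - birkhoffSum S F n (S^[k] x))| ≤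
      2 * N * N := by
    refine (Finset.abs_sum_le_sum_abs _ _).trans ?_
    calc _ ≤ ∑ k ∈ Finset.range N, (2 * N : ℝ) := Finset.sum_le_sum fun k hk =>
          (abs_birkhoffSum_sub_le hF n k x).trans (by
            have : (k : ℝ) ≤ N := by exact_mod_cast (Finset.mem_range.1 hk).le
            linarith)
      _ = _ := by simp; ring
  calc (N : ℝ) * |birkhoffSum S F n x| = |N * birkhoffSum S F n x| := by
        rw [abs_mul, Nat.abs_cast]
    _ ≤ |birkhoffSum S (birkhoffSum S F N) n x| + _ := by rw [h1]; exact abs_add_le _ _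
    _ ≤ _ := add_le_add (Finset.abs_sum_le_sum_abs _ _) h2

variable [MeasurableSpace X]

lemma integrable_of_abs_le {m : Measure X} [IsFiniteMeasure m] {F : X → ℝ} (hFm : Measurable F)
    {C : ℝ} (hF : ∀ x, |F x| ≤ C) : Integrable F m :=
  Integrable.of_bound hFm.aestronglyMeasurable C (Eventually.of_forall hF)

/-- Almost everywhere convergence of ergodic averages of a bounded function whose ergodic averages
tend to zero in mean square. -/
theorem ae_tendsto_birkhoffSum_div_of_mean_square {m : Measure X} [IsProbabilityMeasure m]
    {S : X → X} (hS : MeasurePreserving S m m) {F : X → ℝ} (hFm : Measurable F)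
    (hF : ∀ x, |F x| ≤ 1)
    (hL2 : Tendsto (fun N : ℕ => (∫ x, birkhoffSum S F N x ^ 2 ∂m) / (N : ℝ) ^ 2) atTop (𝓝 0)) :
    ∀ᵐ x ∂m, Tendsto (fun n : ℕ => birkhoffSum S F n x / n) atTop (𝓝 0) := by
  have key : ∀ δ : ℝ, 0 < δ → ∀ᵐ x ∂m, ∀ᶠ n : ℕ in atTop, |birkhoffSum S F n x / n| ≤ 2 * δ := by
    intro δ hδ
    rw [ae_iff]
    refine le_antisymm (ge_of_tendsto (x := atTop)
      (f := fun N : ℕ => ENNReal.ofReal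
        ((∫ x, birkhoffSum S F N x ^ 2 ∂m) / (N : ℝ) ^ 2 / δ ^ 2)) ?_ ?_) (zero_le)
    · have := (ENNReal.tendsto_ofReal (hL2.div_const (δ ^ 2)))
      simpa using this
    filter_upwards [eventually_ge_atTop 1] with N hN
    have hN0 : (0 : ℝ) < N := by exact_mod_cast hN
    have hSm := measurable_birkhoffSum hS.measurable hFm N
    have hpos : (0 : ℝ) < N ^ 2 * δ ^ 2 := by positivity
    -- The maximal inequality for the square of the `N`-th sum at level `(N δ) ^ 2` bounds the
    -- exceptional set by the mean square that tends to zero.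
    have hmax := measure_exists_birkhoffSum_gt_le hS (h := fun x => birkhoffSum S F N x ^ 2)
      (hSm.pow_const 2)
      (integrable_of_abs_le (C := (N : ℝ) ^ 2) (hSm.pow_const 2) fun x => by
        rw [abs_pow]; exact pow_le_pow_left₀ (abs_nonneg _) (abs_birkhoffSum_le hF N x) 2)
      (fun x => sq_nonneg _) hpos
    rw [div_div]
    refine le_trans (measure_mono fun x hx => ?_) hmax
    by_contra hcon
    simp only [Set.mem_ofPred_eq, not_exists, not_lt] at hcon
    refine hx ?_
    -- Beyond `2 N / δ` the boundary error `2 N * N` is at most `N δ n`; the `+ 1` keeps `n`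
    -- positive.
    filter_upwards [eventually_ge_atTop (⌈2 * N / δ⌉₊ + 1)] with n hn
    have hn0 : (0 : ℝ) < n := by
      have : 0 < n := by omega
      exact_mod_cast this
    have hn1 : 2 * N / δ ≤ n := (Nat.le_ceil _).trans (Nat.cast_le.2 ((Nat.le_succ _).trans hn))
    rw [div_le_iff₀ hδ] at hn1
    have h1 := mul_abs_birkhoffSum_le (S := S) hF n N x
    have h2 : 2 * (N * δ) * birkhoffSum S (fun y => |birkhoffSum S F N y|) n x ≤
        n * (N * δ) ^ 2 + birkhoffSum S (fun x => birkhoffSum S F N x ^ 2) n x := by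
      simp only [birkhoffSum]
      rw [Finset.mul_sum]
      have : (n : ℝ) * (N * δ) ^ 2 = ∑ k ∈ Finset.range n, (N * δ) ^ 2 := by simp
      rw [this, ← Finset.sum_add_distrib]
      refine Finset.sum_le_sum fun k _ => ?_
      rw [← sq_abs (∑ k ∈ Finset.range N, F (S^[k] _))]
      exact two_mul_le_add_sq _ _
    have h3 := hcon n
    have h4 : birkhoffSum S (fun y => |birkhoffSum S F N y|) n x ≤ n * (N * δ) := by
      have h5 : (0 : ℝ) < N * δ := by positivity
      have h6 : 2 * (N * δ) * birkhoffSum S (fun y => |birkhoffSum S F N y|) n x ≤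
          2 * (N * δ) * (n * (N * δ)) := by nlinarith
      exact le_of_mul_le_mul_left h6 (by positivity)
    rw [abs_div, Nat.abs_cast, div_le_iff₀ hn0]
    have h7 : (N : ℝ) * |birkhoffSum S F n x| ≤ N * (2 * δ * n) := by nlinarith
    exact le_of_mul_le_mul_left h7 hN0
  have key' : ∀ᵐ x ∂m, ∀ j : ℕ, ∀ᶠ n : ℕ in atTop,
      |birkhoffSum S F n x / n| ≤ 2 * (1 / ((j : ℝ) + 1)) :=
    ae_all_iff.2 fun j => key _ Nat.one_div_pos_of_nat
  filter_upwards [key'] with x hx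
  rw [Metric.tendsto_nhds]
  intro η hη
  obtain ⟨j, hj⟩ := exists_nat_one_div_lt (half_pos hη)
  filter_upwards [hx j] with n hn
  rw [Real.dist_eq, sub_zero]
  linarith

/-- Mean square convergence of ergodic averages follows from decay of correlations in the
Cesàro sense. -/
theorem tendsto_integral_birkhoffSum_sq_div {m : Measure X} [IsProbabilityMeasure m]
    {S : X → X} (hS : MeasurePreserving S m m) {F : X → ℝ} (hFm : Measurable F)
    (hF : ∀ x, |F x| ≤ 1)
    (hcor : Tendsto (fun N : ℕ => (N : ℝ)⁻¹ *
      ∑ k ∈ Finset.range N, ∫ x, F x * F (S^[k] (S x)) ∂m) atTop (𝓝 0)) :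
    Tendsto (fun N : ℕ => (∫ x, birkhoffSum S F N x ^ 2 ∂m) / (N : ℝ) ^ 2) atTop (𝓝 0) := by
  set a : ℕ → ℝ := fun N => (N : ℝ)⁻¹ * ∑ k ∈ Finset.range N, ∫ x, F x * F (S^[k] (S x)) ∂m
  have hSm := measurable_birkhoffSum hS.measurable hFm
  have hbd : ∀ N x, |birkhoffSum S F N x ^ 2| ≤ (N : ℝ) ^ 2 := fun N x => by
    rw [abs_pow]; exact pow_le_pow_left₀ (abs_nonneg _) (abs_birkhoffSum_le hF N x) 2
  -- Square the identity `S_{N+1} F = F + (S_N F) ∘ S` and use invariance; the cross term is `2 N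
  -- a_N`.
  have hrec : ∀ N : ℕ, ∫ x, birkhoffSum S F (N + 1) x ^ 2 ∂m =
      (∫ x, F x ^ 2 ∂m) + 2 * (N * a N) + ∫ x, birkhoffSum S F N x ^ 2 ∂m := by
    intro N
    have hi2 : Integrable (fun x => birkhoffSum S F N x ^ 2) m :=
      integrable_of_abs_le ((hSm N).pow_const 2) (hbd N)
    have e1 : ∫ x, birkhoffSum S F N (S x) ^ 2 ∂m = ∫ x, birkhoffSum S F N x ^ 2 ∂m := by
      rw [← hS.map_eq, integral_map hS.measurable.aemeasurable
        ((hSm N).pow_const 2).aestronglyMeasurable, hS.map_eq]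
    have hik : ∀ k, Integrable (fun x => F x * F (S^[k] (S x))) m := fun k =>
      integrable_of_abs_le (C := 1)
        (hFm.mul (hFm.comp ((hS.measurable.iterate k).comp hS.measurable))) fun x => by
          rw [abs_mul]; exact mul_le_one₀ (hF _) (abs_nonneg _) (hF _)
    have e2 : N * a N = ∫ x, F x * birkhoffSum S F N (S x) ∂m := by
      rcases Nat.eq_zero_or_pos N with rfl | hN
      · simp
      have : (N : ℝ) ≠ 0 := by positivity
      simp only [a, birkhoffSum, Finset.mul_sum]
      rw [integral_finsetSum _ fun k _ => hik k]
      refine Finset.sum_congr rfl fun k _ => ?_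
      field_simp
    have hi3 : Integrable (fun x => F x * birkhoffSum S F N (S x)) m := by
      simp only [birkhoffSum, Finset.mul_sum]
      exact integrable_finsetSum _ fun k _ => hik k
    have hi1 : Integrable (fun x => F x ^ 2) m := integrable_of_abs_le (C := 1)
      (hFm.pow_const 2) fun x => by rw [abs_pow]; exact pow_le_one₀ (abs_nonneg _) (hF x)
    have hi12 : Integrable (fun x => F x ^ 2 + 2 * (F x * birkhoffSum S F N (S x))) m :=
      hi1.add (hi3.const_mul 2)
    have hi4 : Integrable (fun x => birkhoffSum S F N (S x) ^ 2) m :=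
      hS.integrable_comp_of_integrable hi2
    rw [e2, ← e1, ← integral_const_mul, ← integral_add hi1 (hi3.const_mul 2),
      ← integral_add hi12 hi4]
    refine integral_congr_ae (Eventually.of_forall fun x => ?_)
    simp only [birkhoffSum_succ']
    ring
  have hsum : ∀ N : ℕ, ∫ x, birkhoffSum S F N x ^ 2 ∂m =
      N * (∫ x, F x ^ 2 ∂m) + 2 * ∑ k ∈ Finset.range N, k * a k := by
    intro N
    induction N with
    | zero => simp
    | succ N ih => rw [hrec, ih, Finset.sum_range_succ]; push_cast; ring
  have hces : Tendsto (fun N : ℕ => (N : ℝ)⁻¹ * ∑ k ∈ Finset.range N, |a k|) atTop (𝓝 0) :=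
    Tendsto.cesaro (by simpa using hcor.abs)
  have hinv : Tendsto (fun N : ℕ => (∫ x, F x ^ 2 ∂m) * (N : ℝ)⁻¹) atTop (𝓝 0) := by
    simpa using tendsto_inv_atTop_nhds_zero_nat.const_mul (∫ x, F x ^ 2 ∂m)
  refine squeeze_zero (fun N => div_nonneg (integral_nonneg fun x => sq_nonneg _) (sq_nonneg _)) ?_
    (by simpa using hinv.add (hces.const_mul 2))
  intro N
  rcases Nat.eq_zero_or_pos N with rfl | hN
  · simp
  have hN0 : (0 : ℝ) < N := by exact_mod_cast hN
  have h1 : ∑ k ∈ Finset.range N, k * a k ≤ N * ∑ k ∈ Finset.range N, |a k| := by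
    rw [Finset.mul_sum]
    refine Finset.sum_le_sum fun k hk => ?_
    have : (k : ℝ) ≤ N := by exact_mod_cast (Finset.mem_range.1 hk).le
    calc (k : ℝ) * a k ≤ k * |a k| := by gcongr; exact le_abs_self _
      _ ≤ _ := by gcongr
  rw [hsum, div_le_iff₀ (by positivity)]
  have e : (∫ x, F x ^ 2 ∂m) * (N : ℝ)⁻¹ * (N : ℝ) ^ 2 = N * ∫ x, F x ^ 2 ∂m := by
    field_simp
  have e' : (N : ℝ)⁻¹ * (∑ k ∈ Finset.range N, |a k|) * (N : ℝ) ^ 2 =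
      N * ∑ k ∈ Finset.range N, |a k| := by field_simp
  nlinarith

end Correlations

/-! ### Fixed vectors and the mean ergodic theorem -/

section Hilbert

variable {H : Type*} [NormedAddCommGroup H] [InnerProductSpace ℝ H] [CompleteSpace H]

local notation "⟪" x ", " y "⟫" => inner ℝ x y

/-- The averages `⟪x, A_N x⟫` tend to zero iff `x` is orthogonal to the fixed vectors. -/
theorem tendsto_inner_birkhoffAverage_iff (U : H →L[ℝ] H) (hU : ‖U‖ ≤ 1) (x : H) :
    Tendsto (fun N : ℕ => ⟪x, birkhoffAverage ℝ U _root_.id N x⟫) atTop (𝓝 0) ↔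
      ∀ y, U y = y → ⟪x, y⟫ = 0 := by
  set K := U.eqLocus (1 : H →L[ℝ] H)
  have h1 := U.tendsto_birkhoffAverage_orthogonalProjection hU x
  have h2 : Tendsto (fun N : ℕ => ⟪x, birkhoffAverage ℝ U _root_.id N x⟫) atTop
      (𝓝 ⟪x, (K.orthogonalProjectionOnto x : H)⟫) := tendsto_const_nhds.inner h1
  -- The limit is the squared norm of the projection, so it vanishes exactly when `x ∈ Kᗮ`.
  have h3 : ⟪x, (K.orthogonalProjectionOnto x : H)⟫ =
      ‖(K.orthogonalProjectionOnto x : H)‖ ^ 2 := by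
    have h4 : ⟪x - (K.orthogonalProjectionOnto x : H), (K.orthogonalProjectionOnto x : H)⟫ = 0 :=
      Submodule.starProjection_inner_eq_zero x _ (K.orthogonalProjectionOnto x).2
    rw [inner_sub_left, sub_eq_zero] at h4
    rw [h4, real_inner_self_eq_norm_sq]
  have h5 : (∀ y, U y = y → ⟪x, y⟫ = 0) ↔ x ∈ Kᗮ := by
    rw [Submodule.mem_orthogonal']
    exact forall_congr' fun y => Iff.rfl
  constructor
  · intro h
    have h6 := tendsto_nhds_unique h2 h
    rw [h3] at h6
    have h7 : K.orthogonalProjectionOnto x = 0 := by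
      rw [← norm_eq_zero]; simpa using h6
    rw [h5]
    exact Submodule.orthogonalProjectionOnto_eq_zero_iff.1 h7
  · intro h
    rw [h5] at h
    rw [Submodule.orthogonalProjectionOnto_eq_zero_iff.2 h] at h2
    simpa using h2

/-- A vector orthogonal to the vectors fixed by an isometry `U` has vanishing averages of
correlations under the averaged operator `(1 + U + W) / 3`. -/
theorem tendsto_inner_birkhoffAverage_third (U W : H →ₗᵢ[ℝ] H) (P : H →L[ℝ] H)
    (hP : ∀ x, P x = (3⁻¹ : ℝ) • (W x + x + U x)) (x : H)
    (hx : Tendsto (fun N : ℕ => ⟪x, birkhoffAverage ℝ U _root_.id N x⟫) atTop (𝓝 0)) :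
    Tendsto (fun N : ℕ => ⟪x, birkhoffAverage ℝ P _root_.id N x⟫) atTop (𝓝 0) := by
  have hPn : ‖P‖ ≤ 1 := by
    refine P.opNorm_le_bound zero_le_one fun y => ?_
    rw [hP, norm_smul]
    have h1 := (norm_add_le (W y + y) (U y)).trans (add_le_add_left (norm_add_le (W y) y) _)
    rw [U.norm_map, W.norm_map] at h1
    rw [Real.norm_of_nonneg (by norm_num)]
    linarith
  rw [tendsto_inner_birkhoffAverage_iff P hPn]
  have hx' := (tendsto_inner_birkhoffAverage_iff U.toContinuousLinearMap
    U.norm_toContinuousLinearMap_le x).1 hx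
  intro y hy
  refine hx' y ?_
  -- The vector `y` is the midpoint of `W y` and `U y`, which have the same norm as `y`; the
  -- parallelogram law forces all three to coincide.
  have h1 : W y + U y = (2 : ℝ) • y := by
    have h2 : (3 : ℝ) • P y = (3 : ℝ) • y := by rw [hy]
    rw [hP, smul_smul, mul_inv_cancel₀ (by norm_num), one_smul] at h2
    have h3 : W y + U y = (3 : ℝ) • y - y := by rw [← h2]; abel
    rw [h3]
    module
  have h4 := parallelogram_law_with_norm ℝ (W y) (U y)
  rw [h1, norm_smul, U.norm_map, W.norm_map, Real.norm_of_nonneg (by norm_num)] at h4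
  have h5 : ‖W y - U y‖ = 0 := by nlinarith [norm_nonneg (W y - U y)]
  have h6 : W y = U y := sub_eq_zero.1 (norm_eq_zero.1 h5)
  rw [h6, ← two_smul ℝ (U y)] at h1
  exact smul_right_injective H (two_ne_zero (α := ℝ)) h1

end Hilbert

/-! ### Independent uniform steps -/

section Steps

/-- The uniform law on the three kinds of steps: down, horizontal, up. -/
noncomputable def stepLaw : Measure (Fin 3) := (3⁻¹ : ℝ≥0∞) • Measure.count

instance stepLaw.instIsProbabilityMeasure : IsProbabilityMeasure stepLaw := by
  refine ⟨?_⟩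
  simp [stepLaw, Measure.count_apply, ENNReal.inv_mul_cancel]

/-- The law of a sequence of independent uniform steps. -/
noncomputable def stepsLaw : Measure (ℕ → Fin 3) := Measure.infinitePi fun _ => stepLaw

instance stepsLaw.instIsProbabilityMeasure : IsProbabilityMeasure stepsLaw := by
  unfold stepsLaw; infer_instance

/-- Put a step in front of a sequence of steps. -/
def consStep (a : Fin 3) (s : ℕ → Fin 3) : ℕ → Fin 3
  | 0 => a
  | n + 1 => s n

@[simp] lemma consStep_zero (a : Fin 3) (s : ℕ → Fin 3) : consStep a s 0 = a := rfl

@[simp] lemma consStep_succ (a : Fin 3) (s : ℕ → Fin 3) (n : ℕ) :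
    consStep a s (n + 1) = s n := rfl

lemma measurable_consStep : Measurable fun p : Fin 3 × (ℕ → Fin 3) => consStep p.1 p.2 := by
  refine measurable_pi_lambda _ fun n => ?_
  cases n with
  | zero => exact measurable_fst
  | succ n => exact (measurable_pi_apply n).comp measurable_snd

/-- This is the source of every later computation that conditions on the first step. -/
lemma map_consStep :
    (stepLaw.prod stepsLaw).map (fun p => consStep p.1 p.2) = stepsLaw := by
  refine Measure.eq_infinitePi _ fun s t ht => ?_
  obtain ⟨N, hN⟩ : ∃ N, s ⊆ Finset.range (N + 1) :=
    ⟨s.sup id, fun i hi => Finset.mem_range.2 (Nat.lt_succ_of_le (Finset.le_sup (f := id) hi))⟩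
  -- Padding with `univ` turns the index set into an initial segment, from which coordinate `0`
  -- splits off.
  set t' : ℕ → Set (Fin 3) := fun i => if i ∈ s then t i else Set.univ
  have h1 : (fun p : Fin 3 × (ℕ → Fin 3) => consStep p.1 p.2) ⁻¹' ((s : Set ℕ).pi t) =
      t' 0 ×ˢ ((Finset.range N : Finset ℕ) : Set ℕ).pi fun i => t' (i + 1) := by
    ext ⟨a, u⟩
    simp only [Set.mem_preimage, Set.mem_pi, Finset.mem_coe, Set.mem_prod, Finset.mem_range]
    constructor
    · intro h
      refine ⟨?_, fun i _ => ?_⟩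
      · by_cases h0 : 0 ∈ s
        · simpa [t', h0] using h 0 h0
        · simp [t', h0]
      · by_cases h0 : i + 1 ∈ s
        · simpa [t', h0] using h (i + 1) h0
        · simp [t', h0]
    · rintro ⟨h0, h1⟩ i hi
      cases i with
      | zero => simpa [t', hi] using h0
      | succ i =>
        have : i < N := by have := Finset.mem_range.1 (hN hi); omega
        simpa [t', hi] using h1 i this
  have h2 : ∏ i ∈ s, stepLaw (t i) = ∏ i ∈ Finset.range (N + 1), stepLaw (t' i) := by
    rw [← Finset.prod_subset hN (f := fun i => stepLaw (t' i))]
    · exact Finset.prod_congr rfl fun i hi => by simp [t', hi]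
    · intro i _ hi
      simp [t', hi]
  rw [Measure.map_apply measurable_consStep
    (MeasurableSet.pi s.countable_toSet fun i _ => (Set.toFinite _).measurableSet), h1,
    Measure.prod_prod, stepsLaw, Measure.infinitePi_pi _ fun i _ => (Set.toFinite _).measurableSet,
    h2, Finset.prod_range_succ', mul_comm]

variable {Y : Type*} [MeasurableSpace Y]

lemma lintegral_stepLaw (φ : Fin 3 → ℝ≥0∞) : ∫⁻ a, φ a ∂stepLaw = 3⁻¹ * ∑ a, φ a := by
  rw [stepLaw, lintegral_smul_measure, lintegral_count, tsum_fintype, smul_eq_mul]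

lemma integral_stepLaw (φ : Fin 3 → ℝ) : ∫ a, φ a ∂stepLaw = 3⁻¹ * ∑ a, φ a := by
  rw [stepLaw, integral_smul_measure, integral_count]
  simp

lemma measurable_consStep_prod :
    Measurable fun q : Fin 3 × ((ℕ → Fin 3) × Y) => (consStep q.1 q.2.1, q.2.2) :=
  (measurable_consStep.comp (measurable_fst.prodMk (measurable_fst.comp measurable_snd))).prodMk
    (measurable_snd.comp measurable_snd)

lemma map_consStep_prod (ν : Measure Y) [IsProbabilityMeasure ν] :
    (stepLaw.prod (stepsLaw.prod ν)).map (fun q => (consStep q.1 q.2.1, q.2.2)) =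
      stepsLaw.prod ν := by
  have h : (fun q : Fin 3 × ((ℕ → Fin 3) × Y) => (consStep q.1 q.2.1, q.2.2)) =
      Prod.map (fun p : Fin 3 × (ℕ → Fin 3) => consStep p.1 p.2) id ∘
        MeasurableEquiv.prodAssoc.symm := rfl
  have h2 : (stepLaw.prod (stepsLaw.prod ν)).map MeasurableEquiv.prodAssoc.symm =
      (stepLaw.prod stepsLaw).prod ν :=
    ((measurePreserving_prodAssoc stepLaw stepsLaw ν).symm _).map_eq
  rw [h, ← Measure.map_map (measurable_consStep.prodMap measurable_id)
    (MeasurableEquiv.measurable _), h2,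
    ← Measure.map_prod_map _ _ measurable_consStep measurable_id, map_consStep, Measure.map_id]

lemma lintegral_stepsLaw_prod (ν : Measure Y) [IsProbabilityMeasure ν]
    {Φ : (ℕ → Fin 3) × Y → ℝ≥0∞} (hΦ : Measurable Φ) :
    ∫⁻ p, Φ p ∂(stepsLaw.prod ν) =
      3⁻¹ * ∑ a, ∫⁻ p, Φ (consStep a p.1, p.2) ∂(stepsLaw.prod ν) := by
  have hm : Measurable fun q : Fin 3 × ((ℕ → Fin 3) × Y) => Φ (consStep q.1 q.2.1, q.2.2) :=
    hΦ.comp measurable_consStep_prod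
  conv_lhs => rw [← map_consStep_prod ν]
  rw [lintegral_map hΦ measurable_consStep_prod, lintegral_prod _ hm.aemeasurable,
    lintegral_stepLaw]

lemma integral_stepsLaw_prod (ν : Measure Y) [IsProbabilityMeasure ν]
    {Φ : (ℕ → Fin 3) × Y → ℝ} (hΦ : Measurable Φ) {C : ℝ} (hC : ∀ p, |Φ p| ≤ C) :
    ∫ p, Φ p ∂(stepsLaw.prod ν) =
      3⁻¹ * ∑ a, ∫ p, Φ (consStep a p.1, p.2) ∂(stepsLaw.prod ν) := by
  have hm : Measurable fun q : Fin 3 × ((ℕ → Fin 3) × Y) => Φ (consStep q.1 q.2.1, q.2.2) :=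
    hΦ.comp measurable_consStep_prod
  conv_lhs => rw [← map_consStep_prod ν]
  rw [integral_map measurable_consStep_prod.aemeasurable hΦ.aestronglyMeasurable,
    integral_prod _ (integrable_of_abs_le hm fun q => hC _), integral_stepLaw]

end Steps

/-! ### The environment seen from the walk -/

section EnvironmentProcess

variable {Y : Type*}

/-- The horizontal displacement in one step. -/
def horizontalStep (e : Y → ℝ) (p : (ℕ → Fin 3) × Y) : ℝ := if p.1 0 = 1 then e p.2 else 0

/-- The vertical displacement in one step. -/
def verticalStep (p : (ℕ → Fin 3) × Y) : ℝ := ((p.1 0 : ℕ) : ℝ) - 1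

lemma abs_horizontalStep_le {e : Y → ℝ} (he : ∀ y, |e y| ≤ 1) (p : (ℕ → Fin 3) × Y) :
    |horizontalStep e p| ≤ 1 := by
  unfold horizontalStep; split_ifs
  · exact he _
  · simp

lemma abs_verticalStep_le (p : (ℕ → Fin 3) × Y) : |verticalStep p| ≤ 1 := by
  unfold verticalStep
  generalize p.1 0 = a
  fin_cases a <;> norm_num

variable [MeasurableSpace Y]

/-- The motion of the environment under a step of the walk. -/
def moveEnv (θ : Y ≃ᵐ Y) : Fin 3 → (Y ≃ᵐ Y) := ![θ.symm, MeasurableEquiv.refl Y, θ]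

/-- The environment seen from the walk, together with the steps to come. -/
def envStep (θ : Y ≃ᵐ Y) (p : (ℕ → Fin 3) × Y) : (ℕ → Fin 3) × Y :=
  (fun n => p.1 (n + 1), moveEnv θ (p.1 0) p.2)

lemma envStep_consStep (θ : Y ≃ᵐ Y) (a : Fin 3) (s : ℕ → Fin 3) (y : Y) :
    envStep θ (consStep a s, y) = (s, moveEnv θ a y) := rfl

lemma measurable_envStep (θ : Y ≃ᵐ Y) : Measurable (envStep θ) := by
  have h1 : Measurable fun q : Fin 3 × Y => moveEnv θ q.1 q.2 :=
    measurable_from_prod_countable_right fun a => (moveEnv θ a).measurable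
  exact (measurable_pi_lambda _ fun n => (measurable_pi_apply (n + 1)).comp measurable_fst).prodMk
    (h1.comp (g := fun q : Fin 3 × Y => moveEnv θ q.1 q.2)
      (f := fun p : (ℕ → Fin 3) × Y => (p.1 0, p.2))
      (((measurable_pi_apply 0).comp measurable_fst).prodMk measurable_snd))

lemma measurable_horizontalStep {e : Y → ℝ} (he : Measurable e) :
    Measurable (horizontalStep e) :=
  Measurable.ite (((measurable_pi_apply 0).comp measurable_fst) (measurableSet_singleton 1))
    (he.comp measurable_snd) measurable_const

lemma measurable_verticalStep : Measurable (verticalStep (Y := Y)) :=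
  ((measurable_from_top (f := fun a : Fin 3 => ((a : ℕ) : ℝ))).comp
    ((measurable_pi_apply 0).comp measurable_fst)).sub_const 1

variable {ν : Measure Y} {θ : Y ≃ᵐ Y}

lemma measurePreserving_moveEnv (hθ : MeasurePreserving θ ν ν) (a : Fin 3) :
    MeasurePreserving (moveEnv θ a) ν ν := by
  fin_cases a
  · exact hθ.symm
  · exact MeasurePreserving.id ν
  · exact hθ

variable [IsProbabilityMeasure ν]

lemma measurePreserving_prod_moveEnv (hθ : MeasurePreserving θ ν ν) (a : Fin 3) :
    MeasurePreserving (fun p : (ℕ → Fin 3) × Y => (p.1, moveEnv θ a p.2))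
      (stepsLaw.prod ν) (stepsLaw.prod ν) :=
  (MeasurePreserving.id stepsLaw).prod (measurePreserving_moveEnv hθ a)

lemma integral_comp_prod_moveEnv (hθ : MeasurePreserving θ ν ν) (a : Fin 3)
    (Φ : (ℕ → Fin 3) × Y → ℝ) :
    ∫ p, Φ (p.1, moveEnv θ a p.2) ∂(stepsLaw.prod ν) = ∫ p, Φ p ∂(stepsLaw.prod ν) :=
  (measurePreserving_prod_moveEnv hθ a).integral_comp
    ((MeasurableEquiv.refl _).prodCongr (moveEnv θ a)).measurableEmbedding Φ

/-- Given the first step, the remaining steps keep their law and the environment undergoes one of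
three measure preserving maps. -/
theorem measurePreserving_envStep (hθ : MeasurePreserving θ ν ν) :
    MeasurePreserving (envStep θ) (stepsLaw.prod ν) (stepsLaw.prod ν) := by
  refine ⟨measurable_envStep θ, Measure.ext fun B hB => ?_⟩
  have hB' := measurable_envStep θ hB
  rw [Measure.map_apply (measurable_envStep θ) hB, ← lintegral_indicator_one hB',
    lintegral_stepsLaw_prod ν (measurable_one.indicator hB')]
  have h : ∀ a : Fin 3, ∫⁻ p, ((envStep θ) ⁻¹' B).indicator 1 (consStep a p.1, p.2)
      ∂(stepsLaw.prod ν) = (stepsLaw.prod ν) B := fun a => by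
    rw [← (measurePreserving_prod_moveEnv hθ a).measure_preimage hB.nullMeasurableSet,
      ← lintegral_indicator_one ((measurePreserving_prod_moveEnv hθ a).measurable hB)]
    rfl
  simp only [h, Finset.sum_const, Finset.card_univ, Fintype.card_fin, nsmul_eq_mul]
  rw [← mul_assoc]
  norm_num [ENNReal.inv_mul_cancel]

/-- The averaging operator of the lazy vertical walk, acting on observables of the environment. -/
noncomputable def lazyAverage (θ : Y ≃ᵐ Y) (φ : Y → ℝ) (y : Y) : ℝ :=
  3⁻¹ * (φ (θ.symm y) + φ y + φ (θ y))

lemma measurable_lazyAverage {φ : Y → ℝ} (hφ : Measurable φ) : Measurable (lazyAverage θ φ) :=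
  (((hφ.comp θ.symm.measurable).add hφ).add (hφ.comp θ.measurable)).const_mul _

lemma abs_lazyAverage_le {φ : Y → ℝ} (hφ : ∀ y, |φ y| ≤ 1) (y : Y) : |lazyAverage θ φ y| ≤ 1 := by
  have h1 := abs_le.1 (hφ (θ.symm y))
  have h2 := abs_le.1 (hφ y)
  have h3 := abs_le.1 (hφ (θ y))
  rw [abs_le, lazyAverage]
  constructor <;> linarith

lemma measurable_iterate_envStep {F : (ℕ → Fin 3) × Y → ℝ} (hF : Measurable F) (k : ℕ) :
    Measurable fun p => F ((envStep θ)^[k] p) :=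
  hF.comp ((measurable_envStep θ).iterate k)

/-- Conditioning on the first step and using invariance moves the translation onto `φ`; as up and
down are equally likely, the result is again `lazyAverage`. Since the induction changes `φ`, the
claim quantifies over it. The factor `3⁻¹` is the probability that step `k` is horizontal. -/
lemma integral_mul_horizontalStep_iterate (hθ : MeasurePreserving θ ν ν) {e : Y → ℝ}
    (hem : Measurable e) (he : ∀ y, |e y| ≤ 1) (k : ℕ) :
    ∀ φ : Y → ℝ, Measurable φ → (∀ y, |φ y| ≤ 1) →
      ∫ p, φ p.2 * horizontalStep e ((envStep θ)^[k] p) ∂(stepsLaw.prod ν) =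
        3⁻¹ * ∫ y, (lazyAverage θ)^[k] φ y * e y ∂ν := by
  have hbd : ∀ (k : ℕ) (φ : Y → ℝ), (∀ y, |φ y| ≤ 1) → ∀ p : (ℕ → Fin 3) × Y,
      |φ p.2 * horizontalStep e ((envStep θ)^[k] p)| ≤ 1 := fun k φ hφ p => by
    rw [abs_mul]
    exact mul_le_one₀ (hφ _) (abs_nonneg _) (abs_horizontalStep_le he _)
  have hmeas : ∀ (k : ℕ) (φ : Y → ℝ), Measurable φ → Measurable fun p : (ℕ → Fin 3) × Y =>
      φ p.2 * horizontalStep e ((envStep θ)^[k] p) := fun k φ hφ =>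
    (hφ.comp measurable_snd).mul (measurable_iterate_envStep (measurable_horizontalStep hem) k)
  induction k with
  | zero =>
    intro φ hφm hφ
    rw [integral_stepsLaw_prod ν (hmeas 0 φ hφm) (hbd 0 φ hφ)]
    have h : ∫ p : (ℕ → Fin 3) × Y, φ p.2 * e p.2 ∂(stepsLaw.prod ν) = ∫ y, φ y * e y ∂ν := by
      rw [integral_fun_snd (μ := stepsLaw) (ν := ν) (fun y => φ y * e y)]; simp
    simp [Fin.sum_univ_three, horizontalStep, consStep, h]
  | succ k ih =>
    intro φ hφm hφ
    have hi : ∀ ψ : Y → ℝ, Measurable ψ → (∀ y, |ψ y| ≤ 1) → Integrable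
        (fun p : (ℕ → Fin 3) × Y => ψ p.2 * horizontalStep e ((envStep θ)^[k] p))
        (stepsLaw.prod ν) := fun ψ hψm hψ => integrable_of_abs_le (hmeas k ψ hψm) (hbd k ψ hψ)
    rw [Function.iterate_succ_apply, ← ih _ (measurable_lazyAverage hφm) (abs_lazyAverage_le hφ),
      integral_stepsLaw_prod ν (hmeas (k + 1) φ hφm) (hbd (k + 1) φ hφ)]
    simp only [Function.iterate_succ_apply, envStep_consStep]
    have h : ∀ a : Fin 3, ∫ p : (ℕ → Fin 3) × Y,
        φ p.2 * horizontalStep e ((envStep θ)^[k] (p.1, moveEnv θ a p.2)) ∂(stepsLaw.prod ν) =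
        ∫ p, φ ((moveEnv θ a).symm p.2) * horizontalStep e ((envStep θ)^[k] p)
          ∂(stepsLaw.prod ν) := fun a => by
      rw [← integral_comp_prod_moveEnv hθ a
        (fun p => φ ((moveEnv θ a).symm p.2) * horizontalStep e ((envStep θ)^[k] p))]
      simp only [MeasurableEquiv.symm_apply_apply]
    simp only [h]
    rw [Fin.sum_univ_three]
    have i0 := hi (fun y => φ ((moveEnv θ 0).symm y))
      (hφm.comp (moveEnv θ 0).symm.measurable) fun y => hφ _
    have i1 := hi (fun y => φ ((moveEnv θ 1).symm y))
      (hφm.comp (moveEnv θ 1).symm.measurable) fun y => hφ _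
    have i2 := hi (fun y => φ ((moveEnv θ 2).symm y))
      (hφm.comp (moveEnv θ 2).symm.measurable) fun y => hφ _
    have i01 : Integrable (fun p : (ℕ → Fin 3) × Y =>
        φ ((moveEnv θ 0).symm p.2) * horizontalStep e ((envStep θ)^[k] p) +
        φ ((moveEnv θ 1).symm p.2) * horizontalStep e ((envStep θ)^[k] p)) (stepsLaw.prod ν) :=
      i0.add i1
    rw [← integral_add i0 i1, ← integral_add i01 i2, ← integral_const_mul]
    refine integral_congr_ae (Eventually.of_forall fun p => ?_)
    change 3⁻¹ * (φ (θ p.2) * _ + φ p.2 * _ + φ (θ.symm p.2) * _) =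
      3⁻¹ * (φ (θ.symm p.2) + φ p.2 + φ (θ p.2)) * _
    ring

/-- A nonzero first factor requires a horizontal step, which leaves the environment unmoved and
costs another `3⁻¹`. -/
lemma integral_horizontalStep_mul_iterate (hθ : MeasurePreserving θ ν ν) {e : Y → ℝ}
    (hem : Measurable e) (he : ∀ y, |e y| ≤ 1) (k : ℕ) :
    ∫ p, horizontalStep e p * horizontalStep e ((envStep θ)^[k] (envStep θ p))
        ∂(stepsLaw.prod ν) =
      9⁻¹ * ∫ y, (lazyAverage θ)^[k] e y * e y ∂ν := by
  have hm := measurable_horizontalStep hem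
  have hmS := (measurable_iterate_envStep (θ := θ) hm k).comp (measurable_envStep θ)
  have hmm : Measurable fun p : (ℕ → Fin 3) × Y =>
      horizontalStep e p * horizontalStep e ((envStep θ)^[k] (envStep θ p)) := hm.mul hmS
  rw [integral_stepsLaw_prod ν hmm (C := 1) fun p => by
    rw [abs_mul]
    exact mul_le_one₀ (abs_horizontalStep_le he _) (abs_nonneg _) (abs_horizontalStep_le he _)]
  have h := integral_mul_horizontalStep_iterate hθ hem he k e hem he
  have h9 : (9⁻¹ : ℝ) = 3⁻¹ * 3⁻¹ := by norm_num
  rw [h9, mul_assoc, ← h, Fin.sum_univ_three]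
  simp [horizontalStep, consStep, envStep_consStep, moveEnv]

/-- Invariance makes the integral of the later factor independent of the first step, and the first
step is centred. -/
lemma integral_verticalStep_mul_iterate (hθ : MeasurePreserving θ ν ν) (k : ℕ) :
    ∫ p : (ℕ → Fin 3) × Y, verticalStep p * verticalStep ((envStep θ)^[k] (envStep θ p))
        ∂(stepsLaw.prod ν) = 0 := by
  have hm := measurable_verticalStep (Y := Y)
  have hmS := (measurable_iterate_envStep (θ := θ) hm k).comp (measurable_envStep θ)
  have hmm : Measurable fun p : (ℕ → Fin 3) × Y =>
      verticalStep p * verticalStep ((envStep θ)^[k] (envStep θ p)) := hm.mul hmS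
  rw [integral_stepsLaw_prod ν hmm (C := 1) fun p => by
    rw [abs_mul]
    exact mul_le_one₀ (abs_verticalStep_le _) (abs_nonneg _) (abs_verticalStep_le _)]
  have h : ∀ a : Fin 3, ∫ p : (ℕ → Fin 3) × Y, verticalStep (consStep a p.1, p.2) *
      verticalStep ((envStep θ)^[k] (envStep θ (consStep a p.1, p.2))) ∂(stepsLaw.prod ν) =
      (((a : ℕ) : ℝ) - 1) * ∫ p : (ℕ → Fin 3) × Y, verticalStep ((envStep θ)^[k] p)
        ∂(stepsLaw.prod ν) := fun a => by
    rw [← integral_comp_prod_moveEnv hθ a fun p => verticalStep ((envStep θ)^[k] p),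
      ← integral_const_mul]
    rfl
  simp only [h, Fin.sum_univ_three]
  norm_num

theorem ae_tendsto_verticalStep (hθ : MeasurePreserving θ ν ν) :
    ∀ᵐ p ∂(stepsLaw.prod ν),
      Tendsto (fun n : ℕ => birkhoffSum (envStep θ) verticalStep n p / n) atTop (𝓝 0) := by
  have hS := measurePreserving_envStep hθ
  refine ae_tendsto_birkhoffSum_div_of_mean_square hS measurable_verticalStep abs_verticalStep_le
    (tendsto_integral_birkhoffSum_sq_div hS measurable_verticalStep abs_verticalStep_le ?_)
  simp [integral_verticalStep_mul_iterate hθ]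

/-- The composition operator on `L²` of a measure preserving map. -/
noncomputable def koopman {m : Measure Y} {S : Y → Y} (hS : MeasurePreserving S m m) :
    Lp ℝ 2 m →ₗᵢ[ℝ] Lp ℝ 2 m := Lp.compMeasurePreservingₗᵢ ℝ S hS

lemma koopman_toLp {m : Measure Y} {S : Y → Y} (hS : MeasurePreserving S m m) {φ : Y → ℝ}
    (hφ : MemLp φ 2 m) : koopman hS (hφ.toLp φ) =
      (hφ.comp_measurePreserving hS).toLp (φ ∘ S) := rfl

lemma memLp_two_of_abs_le {m : Measure Y} [IsFiniteMeasure m] {φ : Y → ℝ} (hφm : Measurable φ)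
    (hφ : ∀ y, |φ y| ≤ 1) : MemLp φ 2 m :=
  MemLp.of_bound hφm.aestronglyMeasurable 1 (Eventually.of_forall hφ)

lemma inner_toLp {m : Measure Y} {φ ψ : Y → ℝ} (hφ : MemLp φ 2 m) (hψ : MemLp ψ 2 m) :
    inner ℝ (hφ.toLp φ) (hψ.toLp ψ) = ∫ y, φ y * ψ y ∂m := by
  rw [L2.inner_def]
  refine integral_congr_ae ?_
  filter_upwards [hφ.coeFn_toLp, hψ.coeFn_toLp] with y h1 h2
  rw [h1, h2]
  simp [mul_comm]

lemma inner_birkhoffAverage_eq {H : Type*} [NormedAddCommGroup H] [InnerProductSpace ℝ H]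
    (U : H → H) (x : H) (N : ℕ) :
    inner ℝ x (birkhoffAverage ℝ U _root_.id N x) =
      (N : ℝ)⁻¹ * ∑ k ∈ Finset.range N, inner ℝ x (U^[k] x) := by
  simp [birkhoffAverage, birkhoffSum, inner_smul_right, inner_sum]

lemma koopman_iterate_toLp {m : Measure Y} {S : Y → Y} (hS : MeasurePreserving S m m) {φ : Y → ℝ}
    (hφ : MemLp φ 2 m) (k : ℕ) : (koopman hS)^[k] (hφ.toLp φ) =
      (hφ.comp_measurePreserving (hS.iterate k)).toLp (φ ∘ S^[k]) := by
  induction k with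
  | zero => rfl
  | succ k ih => rw [Function.iterate_succ_apply', ih, koopman_toLp]; rfl

lemma inner_birkhoffAverage_koopman {m : Measure Y} {S : Y → Y} (hS : MeasurePreserving S m m)
    {φ : Y → ℝ} (hφ : MemLp φ 2 m) (N : ℕ) :
    inner ℝ (hφ.toLp φ) (birkhoffAverage ℝ (koopman hS) _root_.id N (hφ.toLp φ)) =
      (N : ℝ)⁻¹ * ∑ k ∈ Finset.range N, ∫ y, φ y * φ (S^[k] y) ∂m := by
  rw [inner_birkhoffAverage_eq]
  simp only [koopman_iterate_toLp, inner_toLp]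
  rfl

/-- In `L²`, `lazyAverage` becomes the operator `P` of the Hilbert space argument; boundedness keeps
every iterate in `L²`. -/
lemma tendsto_correlation_lazyAverage (hθ : MeasurePreserving θ ν ν) {e : Y → ℝ}
    (hem : Measurable e) (he : ∀ y, |e y| ≤ 1)
    (hcor : Tendsto (fun N : ℕ => (N : ℝ)⁻¹ * ∑ k ∈ Finset.range N, ∫ y, e y * e (θ^[k] y) ∂ν)
      atTop (𝓝 0)) :
    Tendsto (fun N : ℕ => (N : ℝ)⁻¹ * ∑ k ∈ Finset.range N,
      ∫ y, (lazyAverage θ)^[k] e y * e y ∂ν) atTop (𝓝 0) := by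
  have hθ' : MeasurePreserving θ.symm ν ν := hθ.symm
  set U := koopman hθ
  set W := koopman hθ'
  set P : Lp ℝ 2 ν →L[ℝ] Lp ℝ 2 ν := (3⁻¹ : ℝ) • (W.toContinuousLinearMap +
    ContinuousLinearMap.id ℝ _ + U.toContinuousLinearMap) with hPdef
  have hP : ∀ x, P x = (3⁻¹ : ℝ) • (W x + x + U x) := fun x => rfl
  have hm : MemLp e 2 ν := memLp_two_of_abs_le hem he
  have hit : ∀ k, Measurable ((lazyAverage θ)^[k] e) ∧ ∀ y, |(lazyAverage θ)^[k] e y| ≤ 1 := by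
    intro k
    induction k with
    | zero => exact ⟨hem, he⟩
    | succ k ih =>
      rw [Function.iterate_succ_apply']
      exact ⟨measurable_lazyAverage ih.1, abs_lazyAverage_le ih.2⟩
  have hPk : ∀ k, P^[k] (hm.toLp e) = (memLp_two_of_abs_le (hit k).1 (hit k).2).toLp _ := by
    intro k
    induction k with
    | zero => rfl
    | succ k ih =>
      rw [Function.iterate_succ_apply', ih, hP, koopman_toLp, koopman_toLp]
      simp only [Function.iterate_succ_apply']
      rfl
  have h := tendsto_inner_birkhoffAverage_third U W P hP (hm.toLp e) (by
    simpa only [U, inner_birkhoffAverage_koopman] using hcor)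
  simp only [inner_birkhoffAverage_eq, hPk, inner_toLp] at h
  simpa only [mul_comm (e _)] using h

theorem ae_tendsto_horizontalStep (hθ : MeasurePreserving θ ν ν) {e : Y → ℝ}
    (hem : Measurable e) (he : ∀ y, |e y| ≤ 1)
    (hcor : Tendsto (fun N : ℕ => (N : ℝ)⁻¹ * ∑ k ∈ Finset.range N, ∫ y, e y * e (θ^[k] y) ∂ν)
      atTop (𝓝 0)) :
    ∀ᵐ p ∂(stepsLaw.prod ν),
      Tendsto (fun n : ℕ => birkhoffSum (envStep θ) (horizontalStep e) n p / n)
        atTop (𝓝 0) := by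
  have hS := measurePreserving_envStep hθ
  have hm := measurable_horizontalStep hem
  have hb := abs_horizontalStep_le he
  refine ae_tendsto_birkhoffSum_div_of_mean_square hS hm hb
    (tendsto_integral_birkhoffSum_sq_div hS hm hb ?_)
  simp only [integral_horizontalStep_mul_iterate hθ hem he, ← Finset.mul_sum]
  simpa [mul_left_comm] using
    (tendsto_correlation_lazyAverage hθ hem he hcor).const_mul (9⁻¹ : ℝ)

end EnvironmentProcess

/-! ### Stationarity and correlations of the orientations -/

section AnnealedLaw

open ProbabilityTheory

variable {E : Type*} [MeasurableSpace E]

instance annealedLaw.instIsProbabilityMeasure_of_measurable (μ : Measure E)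
    [IsProbabilityMeasure μ] (T : E ≃ᵐ E) (f : E → I) [hf : Fact (Measurable f)] :
    IsProbabilityMeasure (annealedLaw μ T f) :=
  ⟨by simp [annealedLaw_apply μ T hf.out MeasurableSet.univ]⟩

/-- The translation of the orientations by `y`. -/
def shiftBy (y : ℤ) : (ℤ → ℤˣ) ≃ᵐ (ℤ → ℤˣ) where
  toFun ε z := ε (z + y)
  invFun ε z := ε (z - y)
  left_inv ε := by ext z; simp
  right_inv ε := by ext z; simp
  measurable_toFun := measurable_pi_lambda _ fun z => measurable_pi_apply (z + y)
  measurable_invFun := measurable_pi_lambda _ fun z => measurable_pi_apply (z - y)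

@[simp] lemma shiftBy_apply (y : ℤ) (ε : ℤ → ℤˣ) (z : ℤ) : shiftBy y ε z = ε (z + y) := rfl

@[simp] lemma shiftBy_symm_apply (y : ℤ) (ε : ℤ → ℤˣ) (z : ℤ) :
    (shiftBy y).symm ε z = ε (z - y) := rfl

lemma shiftBy_one_iterate_apply (k : ℕ) (ε : ℤ → ℤˣ) (z : ℤ) :
    ((shiftBy 1)^[k] ε) z = ε (z + k) := by
  induction k generalizing z with
  | zero => simp
  | succ k ih => rw [Function.iterate_succ_apply', shiftBy_apply, ih]; push_cast; ring_nf

/-- Equivariance: `T ^ (y + 1) x = T ^ y (T x)`. With the invariance of `μ` it makes the annealed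
law stationary. -/
lemma map_shiftBy_quenchedLaw (T : E ≃ᵐ E) (f : E → I) (x : E) :
    (quenchedLaw T f x).map (shiftBy 1) = quenchedLaw T f (T x) := by
  refine Measure.eq_infinitePi _ fun s t ht => ?_
  have h : shiftBy 1 ⁻¹' ((s : Set ℤ).pi t) =
      ((s.map (addRightEmbedding 1) : Finset ℤ) : Set ℤ).pi fun z => t (z - 1) := by
    ext ε
    simp only [Set.mem_preimage, Set.mem_pi, Finset.mem_coe, shiftBy_apply, Finset.mem_map,
      addRightEmbedding_apply]
    constructor
    · rintro h _ ⟨y, hy, rfl⟩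
      simpa using h y hy
    · intro h y hy
      simpa using h (y + 1) ⟨y, hy, rfl⟩
  rw [MeasurableEquiv.map_apply, h, quenchedLaw, Measure.infinitePi_pi _ fun i _ => ht (i - 1),
    Finset.prod_map]
  refine Finset.prod_congr rfl fun y _ => ?_
  simp [zpow_add_one]

lemma measurePreserving_shiftBy_one {μ : Measure E} {T : E ≃ᵐ E} (hT : MeasurePreserving T μ μ)
    {f : E → I} (hf : Measurable f) :
    MeasurePreserving (shiftBy 1) (annealedLaw μ T f) (annealedLaw μ T f) := by
  refine ⟨(shiftBy 1).measurable, Measure.ext fun A hA => ?_⟩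
  have hq : Measurable fun x => quenchedLaw T f x A :=
    (Measure.measurable_coe hA).comp (measurable_quenchedLaw T hf)
  rw [MeasurableEquiv.map_apply, annealedLaw_apply μ T hf ((shiftBy 1).measurable hA),
    annealedLaw_apply μ T hf hA]
  simp only [← MeasurableEquiv.map_apply, map_shiftBy_quenchedLaw]
  exact hT.lintegral_comp hq

lemma measurePreserving_shiftBy {μ : Measure E} {T : E ≃ᵐ E} (hT : MeasurePreserving T μ μ)
    {f : E → I} (hf : Measurable f) (y : ℤ) :
    MeasurePreserving (shiftBy y) (annealedLaw μ T f) (annealedLaw μ T f) := by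
  have h1 := measurePreserving_shiftBy_one hT hf
  induction y with
  | zero =>
    convert MeasurePreserving.id (annealedLaw μ T f) using 1
    ext ε z; simp
  | succ n ih =>
    convert h1.comp ih using 1
    ext ε z
    simp [add_comm, add_left_comm]
  | pred n ih =>
    convert (MeasurePreserving.symm _ h1).comp ih using 1
    ext ε z
    simp only [shiftBy_apply, Function.comp_apply, shiftBy_symm_apply]
    ring_nf

/-- The orientation of the horizontal line at level `0`, as a real number. -/
def originSign (ε : ℤ → ℤˣ) : ℝ := ((ε 0 : ℤ) : ℝ)

lemma measurable_signCast : Measurable fun u : ℤˣ => ((u : ℤ) : ℝ) :=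
  (measurable_from_top (f := fun n : ℤ => (n : ℝ))).comp (comap_measurable Units.val)

lemma measurable_originSign : Measurable originSign :=
  measurable_signCast.comp (measurable_pi_apply 0)

lemma abs_signCast (u : ℤˣ) : |((u : ℤ) : ℝ)| = 1 := by
  rcases Int.units_eq_one_or u with rfl | rfl <;> simp

lemma abs_originSign_le (ε : ℤ → ℤˣ) : |originSign ε| ≤ 1 := (abs_signCast _).le

lemma integral_signLaw (p : I) : ∫ u : ℤˣ, ((u : ℤ) : ℝ) ∂(signLaw p) = 2 * (p : ℝ) - 1 := by
  have h0 : (0 : ℝ) ≤ p := p.2.1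
  have h1 : (0 : ℝ) ≤ 1 - p := sub_nonneg.2 p.2.2
  have hi : ∀ m : Measure ℤˣ, IsFiniteMeasure m → Integrable (fun u : ℤˣ => ((u : ℤ) : ℝ)) m :=
    fun m _ => integrable_of_abs_le measurable_signCast fun u => (abs_signCast u).le
  rw [signLaw, integral_add_measure, integral_smul_measure, integral_smul_measure,
    integral_dirac' _ _ measurable_signCast.stronglyMeasurable,
    integral_dirac' _ _ measurable_signCast.stronglyMeasurable, ENNReal.toReal_ofReal h0, ENNReal.toReal_ofReal h1]
  · simp; ring
  · exact (hi _ inferInstance).smul_measure ENNReal.ofReal_ne_top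
  · exact (hi _ inferInstance).smul_measure ENNReal.ofReal_ne_top

lemma integral_quenchedLaw_mul (T : E ≃ᵐ E) (f : E → I) (x : E) {y z : ℤ} (hyz : y ≠ z) :
    ∫ ε, ((ε y : ℤ) : ℝ) * ((ε z : ℤ) : ℝ) ∂(quenchedLaw T f x) =
      (2 * (f ((T.toEquiv ^ y : Equiv.Perm E) x) : ℝ) - 1) *
        (2 * (f ((T.toEquiv ^ z : Equiv.Perm E) x) : ℝ) - 1) := by
  have hind := (iIndepFun_infinitePi
    (P := fun y : ℤ => signLaw (f ((T.toEquiv ^ y : Equiv.Perm E) x)))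
    (X := fun _ (u : ℤˣ) => ((u : ℤ) : ℝ)) (fun _ => measurable_signCast)).indepFun hyz
  have hev : ∀ y : ℤ, ∫ ε, ((ε y : ℤ) : ℝ) ∂(quenchedLaw T f x) =
      2 * (f ((T.toEquiv ^ y : Equiv.Perm E) x) : ℝ) - 1 := fun y => by
    rw [← integral_signLaw, ← Measure.infinitePi_map_eval
      (fun y : ℤ => signLaw (f ((T.toEquiv ^ y : Equiv.Perm E) x))) y,
      integral_map (measurable_pi_apply y).aemeasurable measurable_signCast.aestronglyMeasurable]
    rfl
  have h := hind.integral_fun_mul_eq_mul_integral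
    (measurable_signCast.comp (measurable_pi_apply y)).aestronglyMeasurable
    (measurable_signCast.comp (measurable_pi_apply z)).aestronglyMeasurable
  rw [← hev y, ← hev z]
  exact h

lemma integral_annealedLaw (μ : Measure E) [IsProbabilityMeasure μ] (T : E ≃ᵐ E) {f : E → I}
    (hf : Measurable f) {φ : (ℤ → ℤˣ) → ℝ} (hφm : Measurable φ) {C : ℝ} (hφ : ∀ ε, |φ ε| ≤ C) :
    ∫ ε, φ ε ∂(annealedLaw μ T f) = ∫ x, ∫ ε, φ ε ∂(quenchedLaw T f x) ∂μ := by
  have : Fact (Measurable f) := ⟨hf⟩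
  let κ : Kernel E (ℤ → ℤˣ) := ⟨quenchedLaw T f, measurable_quenchedLaw T hf⟩
  have hκ : annealedLaw μ T f = (κ ∘ₖ Kernel.const Unit μ) () :=
    Measure.comp_eq_comp_const_apply (κ := κ)
  have hi : Integrable φ (annealedLaw μ T f) := integrable_of_abs_le hφm hφ
  rw [hκ] at hi ⊢
  exact Kernel.integral_comp hi

lemma zpow_natCast_apply_eq_iterate (T : E ≃ᵐ E) (k : ℕ) (x : E) :
    (T.toEquiv ^ (k : ℤ) : Equiv.Perm E) x = T^[k] x := by
  rw [zpow_natCast, Equiv.Perm.coe_pow]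
  rfl

/-- Correlations of a centred observable under an ergodic map vanish in the Cesàro sense. -/
theorem tendsto_correlation_of_ergodic {μ : Measure E} [IsProbabilityMeasure μ] {T : E → E}
    (hT : Ergodic T μ) {g : E → ℝ} (hgm : Measurable g) (hg : ∀ x, |g x| ≤ 1)
    (hg0 : ∫ x, g x ∂μ = 0) :
    Tendsto (fun N : ℕ => (N : ℝ)⁻¹ * ∑ k ∈ Finset.range N, ∫ x, g x * g (T^[k] x) ∂μ)
      atTop (𝓝 0) := by
  have hm : MemLp g 2 μ := memLp_two_of_abs_le hgm hg
  have h := (tendsto_inner_birkhoffAverage_iff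
    (koopman hT.toMeasurePreserving).toContinuousLinearMap
    (koopman hT.toMeasurePreserving).norm_toContinuousLinearMap_le (hm.toLp g)).2 ?_
  · simpa only [LinearIsometry.coe_toContinuousLinearMap, inner_birkhoffAverage_koopman] using h
  -- Vectors fixed by the Koopman operator are constant by ergodicity, hence orthogonal to the
  -- centred `g`.
  intro φ hφ
  have hinv : φ ∘ T =ᵐ[μ] φ := by
    have h1 := Lp.coeFn_compMeasurePreserving φ hT.toMeasurePreserving
    have h2 : Lp.compMeasurePreserving T hT.toMeasurePreserving φ = φ := hφ
    rw [h2] at h1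
    exact h1.symm
  obtain ⟨c, hc⟩ := hT.ae_eq_const_of_ae_eq_comp_ae (Lp.aestronglyMeasurable φ) hinv
  rw [L2.inner_def]
  calc ∫ x, inner ℝ (hm.toLp g x) (φ x) ∂μ = ∫ x, c * g x ∂μ := by
        refine integral_congr_ae ?_
        filter_upwards [hc, hm.coeFn_toLp] with x h1 h2
        rw [h1, h2]
        simp
    _ = 0 := by rw [integral_const_mul, hg0, mul_zero]

/-- Correlations of the orientations vanish in the Cesàro sense under the annealed law. -/
theorem tendsto_correlation_originSign {μ : Measure E} [IsProbabilityMeasure μ] {T : E ≃ᵐ E}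
    (hT : Ergodic T μ) {f : E → I} (hf : Measurable f) (hfμ : ∫ x, (f x : ℝ) ∂μ = 1 / 2) :
    Tendsto (fun N : ℕ => (N : ℝ)⁻¹ * ∑ k ∈ Finset.range N,
      ∫ ε, originSign ε * originSign ((shiftBy 1)^[k] ε) ∂(annealedLaw μ T f)) atTop (𝓝 0) := by
  set g : E → ℝ := fun x => 2 * (f x : ℝ) - 1 with hgdef
  have hfm : Measurable fun x => (f x : ℝ) := measurable_subtype_coe.comp hf
  have hgm : Measurable g := (hfm.const_mul 2).sub_const 1
  have hg : ∀ x, |g x| ≤ 1 := fun x => by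
    have h0 : (0 : ℝ) ≤ f x := (f x).2.1
    have h1 : (f x : ℝ) ≤ 1 := (f x).2.2
    rw [abs_le]
    constructor <;> simp only [hgdef] <;> linarith
  have hfi : Integrable (fun x => (f x : ℝ)) μ := integrable_of_abs_le (C := 1) hfm fun x => by
    rw [abs_of_nonneg (f x).2.1]; exact (f x).2.2
  have hg0 : ∫ x, g x ∂μ = 0 := by
    rw [hgdef, integral_sub (hfi.const_mul 2) (integrable_const 1), integral_const_mul, hfμ]
    simp
  -- At `k = 0` the signs are not independent: the left side is `1`. A single term does not affect
  -- the Cesàro limit.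
  have hcorr : ∀ k : ℕ, k ≠ 0 →
      ∫ ε, originSign ε * originSign ((shiftBy 1)^[k] ε) ∂(annealedLaw μ T f) =
        ∫ x, g x * g (T^[k] x) ∂μ := fun k hk => by
    have hm : Measurable fun ε => originSign ε * originSign ((shiftBy 1)^[k] ε) :=
      measurable_originSign.mul (measurable_originSign.comp ((shiftBy 1).measurable.iterate k))
    rw [integral_annealedLaw μ T hf (C := 1) hm fun ε => by
        rw [abs_mul]
        exact mul_le_one₀ (abs_originSign_le _) (abs_nonneg _) (abs_originSign_le _)]
    refine integral_congr_ae (Eventually.of_forall fun x => ?_)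
    have h := integral_quenchedLaw_mul T f x (y := 0) (z := k) (by exact_mod_cast hk.symm)
    simp only [zpow_natCast_apply_eq_iterate, zpow_zero, Equiv.Perm.one_apply] at h
    simpa only [originSign, shiftBy_one_iterate_apply, zero_add] using h
  have h1 := tendsto_correlation_of_ergodic hT hgm hg hg0
  have h2 : Tendsto (fun k : ℕ =>
      (∫ ε, originSign ε * originSign ((shiftBy 1)^[k] ε) ∂(annealedLaw μ T f)) -
        ∫ x, g x * g (T^[k] x) ∂μ) atTop (𝓝 0) :=
    tendsto_const_nhds.congr' (by
      filter_upwards [eventually_ne_atTop 0] with k hk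
      rw [hcorr k hk, sub_self])
  refine (by simpa using h1.add h2.cesaro : Tendsto _ atTop (𝓝 (0 : ℝ))).congr fun N => ?_
  rw [← mul_add]
  simp

end AnnealedLaw

/-! ### The law of the walk and its representation by steps -/

section WalkLaw

/-- The position after one step from `u`: down, horizontal or up. -/
def stepFrom (ε : ℤ → ℤˣ) (u : ℤ × ℤ) (a : Fin 3) : ℤ × ℤ :=
  if a = 1 then (u.1 + (ε u.2 : ℤ), u.2) else (u.1, u.2 + (((a : ℕ) : ℤ) - 1))

/-- The walk started from `u` that uses the steps `s`. -/
def walkPath (ε : ℤ → ℤˣ) : ℤ × ℤ → (ℕ → Fin 3) → ℕ → ℤ × ℤ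
  | u, _, 0 => u
  | u, s, n + 1 => walkPath ε (stepFrom ε u (s 0)) (fun k => s (k + 1)) n

lemma measurable_walkPath (ε : ℤ → ℤˣ) (u : ℤ × ℤ) : Measurable (walkPath ε u) := by
  have hn : ∀ (n : ℕ) (u : ℤ × ℤ), Measurable fun s => walkPath ε u s n := by
    intro n
    induction n with
    | zero => exact fun u => measurable_const
    | succ n ih =>
      intro u
      have h : Measurable fun q : Fin 3 × (ℕ → Fin 3) => walkPath ε (stepFrom ε u q.1) q.2 n :=
        measurable_from_prod_countable_right fun a => ih (stepFrom ε u a)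
      exact h.comp (g := fun q : Fin 3 × (ℕ → Fin 3) => walkPath ε (stepFrom ε u q.1) q.2 n)
        (f := fun s : ℕ → Fin 3 => (s 0, fun k => s (k + 1)))
        ((measurable_pi_apply 0).prodMk (measurable_pi_lambda _ fun k => measurable_pi_apply _))
  exact measurable_pi_lambda _ fun n => hn n u

lemma measurable_walkPath_prod (ε : ℤ → ℤˣ) :
    Measurable fun q : (ℤ × ℤ) × (ℕ → Fin 3) => walkPath ε q.1 q.2 :=
  measurable_from_prod_countable_right fun u => measurable_walkPath ε u

lemma stepsLaw_apply {A : Set (ℕ → Fin 3)} (hA : MeasurableSet A) :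
    stepsLaw A = 3⁻¹ * ∑ a, stepsLaw {s | consStep a s ∈ A} := by
  conv_lhs => rw [← map_consStep]
  rw [Measure.map_apply measurable_consStep hA, Measure.prod_apply (measurable_consStep hA),
    lintegral_stepLaw]
  rfl

/-- The three steps have distinct endpoints, since a sign is nonzero, so each edge is produced by
exactly one of them. -/
lemma sum_ite_stepFrom (ε : ℤ → ℤˣ) (u v : ℤ × ℤ) :
    3⁻¹ * ∑ a : Fin 3, (if stepFrom ε u a = v then (1 : ℝ≥0∞) else 0) =
      transitionProb ε u v := by
  obtain ⟨u1, u2⟩ := u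
  obtain ⟨v1, v2⟩ := v
  have hε : (ε u2 : ℤ) ≠ 0 := (ε u2).ne_zero
  simp only [Fin.sum_univ_three, stepFrom, transitionProb, orientedLattice,
    show ¬ (0 : Fin 3) = 1 by decide, show ¬ (2 : Fin 3) = 1 by decide, if_true, if_false,
    Prod.mk.injEq]
  norm_num
  by_cases h1 : v1 = u1
  · subst h1
    by_cases h2 : v2 = u2 + 1
    · subst h2
      simp [hε]
    · by_cases h3 : v2 = u2 - 1
      · subst h3
        simp [hε, sub_eq_add_neg]
      · have h2' : ¬ u2 + 1 = v2 := fun h => h2 h.symm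
        have h3' : ¬ u2 + -1 = v2 := fun h => h3 (by omega)
        simp [hε, h2, h3, h2', h3']
  · have h1' : ¬ u1 = v1 := fun h => h1 h.symm
    by_cases h2 : v2 = u2 ∧ v1 = u1 + (ε u2 : ℤ)
    · simp [h1, h1', if_pos h2, if_pos (show u1 + (ε u2 : ℤ) = v1 ∧ u2 = v2 from
        ⟨h2.2.symm, h2.1.symm⟩)]
    · have h3 : ¬ (u1 + (ε u2 : ℤ) = v1 ∧ u2 = v2) := fun h => h2 ⟨h.2.symm, h.1.symm⟩
      simp only [h1, h1', h2, h3, false_and, or_self, if_false, add_zero,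
        mul_zero]

lemma measurableSet_cylinder_path (n : ℕ) (w : ℕ → ℤ × ℤ) :
    MeasurableSet {v : ℕ → ℤ × ℤ | ∀ k ≤ n, v k = w k} := by
  have : {v : ℕ → ℤ × ℤ | ∀ k ≤ n, v k = w k} = ⋂ k, ⋂ _ : k ≤ n, {v | v k = w k} := by
    ext v; simp
  rw [this]
  exact MeasurableSet.iInter fun k => MeasurableSet.iInter fun _ =>
    (measurable_pi_apply (X := fun _ : ℕ => ℤ × ℤ) k) (measurableSet_singleton (w k))

lemma stepsLaw_walkPath (ε : ℤ → ℤˣ) (n : ℕ) :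
    ∀ (u : ℤ × ℤ) (w : ℕ → ℤ × ℤ), stepsLaw {s | ∀ k ≤ n, walkPath ε u s k = w k} =
      if u = w 0 then ∏ k ∈ Finset.range n, transitionProb ε (w k) (w (k + 1)) else 0 := by
  induction n with
  | zero =>
    intro u w
    by_cases h : u = w 0 <;> simp [walkPath, h]
  | succ n ih =>
    intro u w
    have hset : ∀ a : Fin 3, {s | consStep a s ∈ {s | ∀ k ≤ n + 1, walkPath ε u s k = w k}} =
        {s | u = w 0 ∧ ∀ k ≤ n, walkPath ε (stepFrom ε u a) s k = w (k + 1)} := by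
      intro a
      ext s
      simp only [Set.mem_ofPred_eq]
      constructor
      · exact fun h => ⟨h 0 (Nat.zero_le _), fun k hk => h (k + 1) (by omega)⟩
      · rintro ⟨h0, h⟩ k hk
        cases k with
        | zero => exact h0
        | succ k => exact h k (by omega)
    have hm : MeasurableSet {s | ∀ k ≤ n + 1, walkPath ε u s k = w k} :=
      measurable_walkPath ε u (measurableSet_cylinder_path (n + 1) w)
    rw [stepsLaw_apply hm]
    simp only [hset]
    by_cases h : u = w 0
    · simp only [h, true_and, if_true]
      have h2 : ∀ a : Fin 3,
          stepsLaw {s | ∀ k ≤ n, walkPath ε (stepFrom ε (w 0) a) s k = w (k + 1)} =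
          (if stepFrom ε (w 0) a = w 1 then 1 else 0) *
            ∏ k ∈ Finset.range n, transitionProb ε (w (k + 1)) (w (k + 1 + 1)) := fun a => by
        rw [ih _ fun k => w (k + 1)]
        simp
      simp only [h2]
      rw [← Finset.sum_mul, ← mul_assoc, sum_ite_stepFrom, Finset.prod_range_succ', mul_comm]
    · simp [h]

lemma IsSimpleRandomWalk.measure_cylinder {Ω : Type*} [MeasurableSpace Ω] {P : Measure Ω}
    {ε : ℤ → ℤˣ} {M : ℕ → Ω → ℤ × ℤ} (h : IsSimpleRandomWalk P ε M) (n : ℕ) (w : ℕ → ℤ × ℤ) :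
    P {ω | ∀ k ≤ n, M k ω = w k} =
      P {ω | M 0 ω = w 0} * ∏ k ∈ Finset.range n, transitionProb ε (w k) (w (k + 1)) := by
  induction n with
  | zero => simp
  | succ n ih => rw [h.markov, ih, Finset.prod_range_succ, mul_assoc]

/-- A finite measure on sequences of lattice points is determined by its values on cylinders. -/
lemma ext_of_cylinder_path {m m' : Measure (ℕ → ℤ × ℤ)} [IsFiniteMeasure m]
    (h : ∀ (n : ℕ) (w : ℕ → ℤ × ℤ), m {v | ∀ k ≤ n, v k = w k} = m' {v | ∀ k ≤ n, v k = w k}) :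
    m = m' := by
  let Q : (J : Finset ℕ) → Measure (∀ _ : J, ℤ × ℤ) := fun J => m.map J.restrict
  have hQ : IsProjectiveMeasureFamily (α := fun _ : ℕ => ℤ × ℤ) Q := by
    intro J K hJK
    simp only [Q]
    rw [Measure.map_map (Finset.measurable_restrict₂ hJK) (Finset.measurable_restrict J)]
    rfl
  have h1 : IsProjectiveLimit m Q := fun J => rfl
  have h2 : IsProjectiveLimit m' Q := by
    -- Initial segments of times suffice; path segments form a countable set, so singletons, that is
    -- cylinders, determine the marginals.
    rw [isProjectiveLimit_nat_iff hQ]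
    intro n
    refine Measure.ext_of_singleton fun v => ?_
    let w : ℕ → ℤ × ℤ := fun k => if hk : k ≤ n then v ⟨k, Finset.mem_Iic.2 hk⟩ else 0
    have hset : (Preorder.frestrictLe (π := fun _ : ℕ => ℤ × ℤ) n) ⁻¹' {v} =
        {v' | ∀ k ≤ n, v' k = w k} := by
      ext v'
      simp only [Set.mem_preimage, Set.mem_singleton_iff, Set.mem_ofPred_eq]
      constructor
      · rintro rfl k hk
        simp [w, hk]
      · intro hv
        ext1 ⟨k, hk⟩
        have hk' := Finset.mem_Iic.1 hk
        have := hv k hk'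
        simpa [w, hk'] using this
    rw [Measure.map_apply (by fun_prop) (measurableSet_singleton v), hset, ← h, ← hset]
    exact (Measure.map_apply (Finset.measurable_restrict _) (measurableSet_singleton v)).symm
  exact h1.unique h2

/-- The law of the simple random walk on the oriented lattice: independent uniform steps, started
from an independent initial position. -/
theorem IsSimpleRandomWalk.map_eq {Ω : Type*} [MeasurableSpace Ω] {P : Measure Ω}
    [IsProbabilityMeasure P] {ε : ℤ → ℤˣ} {M : ℕ → Ω → ℤ × ℤ} (h : IsSimpleRandomWalk P ε M) :
    P.map (fun ω n => M n ω) =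
      ((P.map (M 0)).prod stepsLaw).map fun q => walkPath ε q.1 q.2 := by
  have hM : Measurable fun ω n => M n ω := measurable_pi_lambda _ h.measurable
  have : IsProbabilityMeasure (P.map (M 0)) :=
    Measure.isProbabilityMeasure_map (h.measurable 0).aemeasurable
  have : IsProbabilityMeasure (P.map (fun ω n => M n ω)) :=
    Measure.isProbabilityMeasure_map hM.aemeasurable
  refine ext_of_cylinder_path fun n w => ?_
  have hC := measurableSet_cylinder_path n w
  rw [Measure.map_apply hM hC, Measure.map_apply (measurable_walkPath_prod ε) hC,
    Measure.prod_apply (measurable_walkPath_prod ε hC)]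
  refine (h.measure_cylinder n w).trans ?_
  have h1 : ∀ u : ℤ × ℤ, stepsLaw (Prod.mk u ⁻¹' ((fun q : (ℤ × ℤ) × (ℕ → Fin 3) =>
      walkPath ε q.1 q.2) ⁻¹' {v | ∀ k ≤ n, v k = w k})) = ({w 0} : Set (ℤ × ℤ)).indicator
        (fun _ => ∏ k ∈ Finset.range n, transitionProb ε (w k) (w (k + 1))) u := fun u => by
    refine (stepsLaw_walkPath ε n u w).trans ?_
    simp [Set.indicator_apply]
  simp only [h1]
  rw [lintegral_indicator_const (measurableSet_singleton _),
    Measure.map_apply (h.measurable 0) (measurableSet_singleton _), mul_comm]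
  rfl

lemma moveEnv_shiftBy (a : Fin 3) (y : ℤ) (ε : ℤ → ℤˣ) :
    moveEnv (shiftBy 1) a (shiftBy y ε) = shiftBy (y + (((a : ℕ) : ℤ) - 1)) ε := by
  ext z
  fin_cases a
  · change ((ε (z - 1 + y) : ℤˣ) : ℤ) = ε (z + (y + (((0 : ℕ) : ℤ) - 1)))
    congr 2; push_cast; ring
  · change ((ε (z + y) : ℤˣ) : ℤ) = ε (z + (y + (((1 : ℕ) : ℤ) - 1)))
    congr 2; push_cast; ring
  · change ((ε (z + 1 + y) : ℤˣ) : ℤ) = ε (z + (y + (((2 : ℕ) : ℤ) - 1)))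
    congr 2; push_cast; ring

/-- The walk as a pair of additive functionals of the environment seen from it. -/
lemma walkPath_eq_birkhoffSum (ε : ℤ → ℤˣ) (n : ℕ) : ∀ (u : ℤ × ℤ) (s : ℕ → Fin 3),
    ((walkPath ε u s n).1 : ℝ) = u.1 +
      birkhoffSum (envStep (shiftBy 1)) (horizontalStep originSign) n (s, shiftBy u.2 ε) ∧
    ((walkPath ε u s n).2 : ℝ) = u.2 +
      birkhoffSum (envStep (shiftBy 1)) verticalStep n (s, shiftBy u.2 ε) := by
  induction n with
  | zero => intro u s; simp [walkPath]
  | succ n ih =>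
    intro u s
    -- Only the height of the walker enters: the lattice is invariant under horizontal translations.
    have hS : envStep (shiftBy 1) (s, shiftBy u.2 ε) =
        (fun k => s (k + 1), shiftBy (stepFrom ε u (s 0)).2 ε) := by
      rw [envStep, moveEnv_shiftBy]
      congr 2
      unfold stepFrom
      split_ifs with h
      · simp [h]
      · rfl
    rw [birkhoffSum_succ', birkhoffSum_succ', hS, walkPath, (ih _ _).1, (ih _ _).2, ← add_assoc,
      ← add_assoc]
    constructor
    · congr 1
      unfold stepFrom horizontalStep originSign
      split_ifs <;> simp
    · congr 1
      unfold stepFrom verticalStep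
      split_ifs with h
      · simp [h]
      · push_cast; rfl

lemma tendsto_walkPath_div {ε : ℤ → ℤˣ} {u : ℤ × ℤ} {s : ℕ → Fin 3}
    (h1 : Tendsto (fun n : ℕ => birkhoffSum (envStep (shiftBy 1)) (horizontalStep originSign) n
      (s, shiftBy u.2 ε) / n) atTop (𝓝 0))
    (h2 : Tendsto (fun n : ℕ => birkhoffSum (envStep (shiftBy 1)) verticalStep n
      (s, shiftBy u.2 ε) / n) atTop (𝓝 0)) :
    Tendsto (fun n : ℕ => (((walkPath ε u s n).1 : ℝ) / (n : ℝ),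
      ((walkPath ε u s n).2 : ℝ) / (n : ℝ))) atTop (𝓝 ((0 : ℝ), (0 : ℝ))) := by
  simp only [(walkPath_eq_birkhoffSum ε _ u s).1, (walkPath_eq_birkhoffSum ε _ u s).2, add_div]
  refine Tendsto.prodMk_nhds ?_ ?_
  · simpa using (tendsto_const_div_atTop_nhds_zero_nat (u.1 : ℝ)).add h1
  · simpa using (tendsto_const_div_atTop_nhds_zero_nat (u.2 : ℝ)).add h2

/-- The sequences of lattice points with zero asymptotic speed. -/
def zeroSpeed : Set (ℕ → ℤ × ℤ) :=
  {w | Tendsto (fun n : ℕ => (((w n).1 : ℝ) / (n : ℝ), ((w n).2 : ℝ) / (n : ℝ)))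
    atTop (𝓝 ((0 : ℝ), (0 : ℝ)))}

lemma measurableSet_zeroSpeed : MeasurableSet zeroSpeed := by
  have hc : Measurable fun u : ℤ × ℤ => ((u.1 : ℝ), (u.2 : ℝ)) := measurable_of_countable _
  refine measurableSet_tendsto (𝓝 ((0 : ℝ), (0 : ℝ))) fun n => ?_
  have h := hc.comp (measurable_pi_apply (X := fun _ : ℕ => ℤ × ℤ) n)
  exact (h.fst.div_const _).prodMk (h.snd.div_const _)

end WalkLaw

/-! ### Conclusion by Fubini -/

theorem mainTheorem2
    {E : Type*} [MeasurableSpace E] (μ : Measure E) [IsProbabilityMeasure μ]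
    (T : E ≃ᵐ E) (hT : Ergodic T μ)
    (f : E → I) (hf : Measurable f) (hfμ : ∫ x, (f x : ℝ) ∂μ = 1 / 2)
    {Ω : Type*} [MeasurableSpace Ω] (P : Measure Ω) [IsProbabilityMeasure P]
    (M : ℕ → Ω × (ℤ → ℤˣ) → ℤ × ℤ) (hM : ∀ n, Measurable (M n))
    (hwalk : ∀ ε : ℤ → ℤˣ, IsSimpleRandomWalk P ε fun n ω => M n (ω, ε)) :
    ∀ᵐ p ∂(P.prod (annealedLaw μ T f)),
      Tendsto (fun n : ℕ => (((M n p).1 : ℝ) / (n : ℝ), ((M n p).2 : ℝ) / (n : ℝ)))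
        atTop (𝓝 ((0 : ℝ), (0 : ℝ))) := by
  have : Fact (Measurable f) := ⟨hf⟩
  have hθ := measurePreserving_shiftBy_one hT.toMeasurePreserving hf
  have hstat : ∀ᵐ ε ∂(annealedLaw μ T f), ∀ᵐ s ∂stepsLaw,
      Tendsto (fun n : ℕ => birkhoffSum (envStep (shiftBy 1)) (horizontalStep originSign) n
        (s, ε) / n) atTop (𝓝 0) ∧
      Tendsto (fun n : ℕ => birkhoffSum (envStep (shiftBy 1)) verticalStep n
        (s, ε) / n) atTop (𝓝 0) :=
    Measure.ae_ae_of_ae_prod (Measure.measurePreserving_swap.quasiMeasurePreserving.ae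
      ((ae_tendsto_horizontalStep hθ measurable_originSign abs_originSign_le
        (tendsto_correlation_originSign hT hf hfμ)).and (ae_tendsto_verticalStep hθ)))
  -- The law of the starting point may depend on `ε`, so one null set must serve all `u`;
  -- stationarity handles each height, and `ℤ × ℤ` is countable.
  have hquenched : ∀ᵐ ε ∂(annealedLaw μ T f), ∀ u : ℤ × ℤ, ∀ᵐ s ∂stepsLaw,
      walkPath ε u s ∈ zeroSpeed := by
    rw [ae_all_iff]
    intro u
    filter_upwards [(measurePreserving_shiftBy hT.toMeasurePreserving hf
      u.2).quasiMeasurePreserving.ae hstat] with ε hε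
    filter_upwards [hε] with s hs
    exact tendsto_walkPath_div hs.1 hs.2
  have hpath : Measurable fun (p : Ω × (ℤ → ℤˣ)) n => M n p := measurable_pi_lambda _ hM
  have hB : MeasurableSet {p : Ω × (ℤ → ℤˣ) | (fun n => M n p) ∈ zeroSpeedᶜ} :=
    hpath measurableSet_zeroSpeed.compl
  rw [ae_iff]
  change P.prod (annealedLaw μ T f) {p | (fun n => M n p) ∈ zeroSpeedᶜ} = 0
  rw [Measure.prod_apply_symm hB, lintegral_eq_zero_iff (measurable_measure_prodMk_right hB)]
  filter_upwards [hquenched] with ε hε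
  have hw := hwalk ε
  have : IsProbabilityMeasure (P.map fun ω => M 0 (ω, ε)) :=
    Measure.isProbabilityMeasure_map (hw.measurable 0).aemeasurable
  have hZ := measurableSet_zeroSpeed.compl
  -- For fixed `ε`, the path law is a mixture over starting points of laws that do not charge
  -- `zeroSpeedᶜ`.
  have h1 := congrArg (fun m => m zeroSpeedᶜ) hw.map_eq
  beta_reduce at h1
  rw [Measure.map_apply (measurable_pi_lambda _ hw.measurable) hZ,
    Measure.map_apply (measurable_walkPath_prod ε) hZ,
    Measure.prod_apply (measurable_walkPath_prod ε hZ)] at h1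
  refine h1.trans ?_
  rw [Pi.zero_apply, lintegral_eq_zero_iff (measurable_measure_prodMk_left (measurable_walkPath_prod ε hZ))]
  exact Eventually.of_forall fun u => hε u
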